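/- Let $d\ge 1$, let $\|\cdot\|$ be an arbitrary norm on $\mathbb{R}^d$, and for a finite nonempty set $\mathcal{C}\subset\mathbb{R}^d$ (a codebook, whose size is its number of elements) write $d(x,\mathcal{C})=\min_{y\in\mathcal{C}}\|x-y\|$. Let $\varphi:[0,\infty)\to[0,\infty)$ be increasing (not necessarily strictly), left continuous, not identically zero, with $\lim_{t\downarrow0}\varphi(t)=0$. For a nonnegative random variable $Z$ put $$\|Z\|_\varphi=\inf\{t>0:\ \mathbb{E}\,\varphi(Z/t)\le 1\},\qquad \inf\emptyset=\infty.$$ Let $U$ be uniformly distributed on $[0,1)^d$. For $\eta>0$ define $$g(\eta)=\inf_{N\ge 1}\ \inf_{|\mathcal{C}|=\lfloor N\rfloor}\ \mathbb{E}\,\varphi\bigl((N/\eta)^{1/d}\,d(U,\mathcal{C})\bigr),$$ where the first infimum is over real $N\ge1$ and the second over all finite $\mathcal{C}\subset\mathbb{R}^d$ with exactly $\lfloor N\rfloor$ elements, and put $g(0)=\liminf_{\eta\downarrow0}g(\eta)\in[0,\infty]$. Let $X$ be an $\mathbb{R}^d$-valued random vector with law $\mu$, let $\lambda^d$ be Lebesgue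 measure and let $\mu_c$ be the absolutely continuous part of $\mu$ with respect to $\lambda^d$. Let $$I=\inf\Bigl\{\int_{\mathbb{R}^d}\xi(x)\,dx:\ \xi\ge0\ \text{Lebesgue integrable},\ \int_{\mathbb{R}^d} g(\xi(x))\,d\mu_c(x)\le1\Bigr\}\in[0,\infty]$$ be the minimal value of the point allocation problem, and, when $I\in(0,\infty)$, let $\mathcal{M}$ be the set of all probability measures $\nu$ on $\mathbb{R}^d$ having a Lebesgue density $\bar\xi:\mathbb{R}^d\to[0,\infty)$ with $$\int_{\mathbb{R}^d} g(I\,\bar\xi(x))\,d\mu_c(x)=1,\qquad \int_{\mathbb{R}^d}\bar\xi(x)\,dx=1 .$$ **Theorem.** Assume that $I\in(0,\infty)$ and that the codebooks $\mathcal{C}(N)\subset\mathbb{R}^d$, $N\in\{1,2,\dots\}$, of size $|\mathcal{C}(N)|=N$ are asymptotically optimal, that is, $$\limsup_{N\to\infty}N^{1/d}\,\|d(X,\mathcal{C}(N))\|_\varphi\le I^{1/d}.$$ Then the empirical measures $\nu_N=\frac1N\sum_{\hat x\in\mathcal{C}(N)}\delta_{\hat x}$ form a tight sequence of probability measures, and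 every accumulation point of $(\nu_N)_{N\ge1}$ in the weak topology lies in $\mathcal{M}$. If, moreover, $g$ is strictly convex on $(0,\infty)$, then $\mathcal{M}$ consists of exactly one measure $\nu$, and $\nu_N\to\nu$ weakly as $N\to\infty$. -/

import Mathlib

open MeasureTheory Filter Topology Set
open scoped NNReal ENNReal

noncomputable section

namespace OrliczQuantization

/-- The class of functions `φ : [0,∞) → [0,∞)` used to define Orlicz norms: increasing (in the weak
sense), left continuous, with `φ(t) → 0` as `t ↓ 0`, and not identically zero. Convexity is not
required. -/
structure IsOrliczFunction (φ : ℝ≥0 → ℝ≥0) : Prop where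
  monotone : Monotone φ
  leftContinuous : ∀ t, ContinuousWithinAt φ (Iic t) t
  tendsto_zero : Tendsto φ (𝓝[>] 0) (𝓝 0)
  ne_zero : φ ≠ 0

/-- The Orlicz norm `inf {t : 𝔼 φ(Z/t) ≤ 1}` of a nonnegative random variable `Z`, with
`inf ∅ = ∞`. Only `t > 0` is allowed, since `Z / 0` is not meaningful here; by monotonicity of `φ`
the value `t = 0` (read with `Z/0 = ∞` where `Z > 0`) would not change the infimum. -/
def orliczNorm (φ : ℝ≥0 → ℝ≥0) {Ω : Type*} [MeasurableSpace Ω] (P : Measure Ω)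
    (Z : Ω → ℝ≥0) : ℝ≥0∞ :=
  ⨅ (t : ℝ≥0) (_ : 0 < t) (_ : ∫⁻ ω, (φ (Z ω / t) : ℝ≥0∞) ∂P ≤ 1), (t : ℝ≥0∞)

variable {d : ℕ}

/-- The distance `min_{y ∈ C} ‖x - y‖` of `x ∈ ℝᵈ` to a finite nonempty codebook `C`, where the norm
on `ℝᵈ` is `p`. (For `C = ∅` the value is a junk `0`; empty codebooks never occur below.) -/
def codebookDist (p : Seminorm ℝ (Fin d → ℝ)) (C : Finset (Fin d → ℝ)) (x : Fin d → ℝ) : ℝ≥0 :=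
  ⨅ y : C, (p (x - y)).toNNReal

/-- The half-open unit cube `[0,1)ᵈ`. -/
def unitCube (d : ℕ) : Set (Fin d → ℝ) := Set.univ.pi fun _ => Ico (0 : ℝ) 1

/-- For real `N ≥ 1` and `η > 0`: the infimum of `𝔼 φ((N/η)^{1/d} d(U, C))` over all codebooks `C`
of size `⌊N⌋`, where `U` is uniformly distributed on `[0,1)ᵈ`. -/
def uniformError (p : Seminorm ℝ (Fin d → ℝ)) (φ : ℝ≥0 → ℝ≥0) (N η : ℝ≥0) : ℝ≥0∞ :=
  ⨅ (C : Finset (Fin d → ℝ)) (_ : C.card = ⌊N⌋₊),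
    ∫⁻ x in unitCube d, (φ ((N / η) ^ (1 / (d : ℝ)) * codebookDist p C x) : ℝ≥0∞)

/-- The function `g(η) = inf_{N ≥ 1} f_N(η)` for `η > 0`, where `f_N` is `uniformError`
(the value at `η = 0` is not used). -/
def gPos (p : Seminorm ℝ (Fin d → ℝ)) (φ : ℝ≥0 → ℝ≥0) (η : ℝ≥0) : ℝ≥0∞ :=
  ⨅ (N : ℝ≥0) (_ : 1 ≤ N), uniformError p φ N η

/-- The function `g` on `[0,∞)`, extended to `0` by `g(0) = liminf_{η ↓ 0} g(η) ∈ [0,∞]`. -/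
def g (p : Seminorm ℝ (Fin d → ℝ)) (φ : ℝ≥0 → ℝ≥0) (η : ℝ≥0) : ℝ≥0∞ :=
  if η = 0 then liminf (gPos p φ) (𝓝[>] 0) else gPos p φ η

/-- The absolutely continuous part of a measure `μ` with respect to Lebesgue measure. -/
def acPart (μ : Measure (Fin d → ℝ)) : Measure (Fin d → ℝ) :=
  volume.withDensity (μ.rnDeriv volume)

/-- The minimal value `I` of the point allocation problem: the infimum of `∫ ξ dx` over all
nonnegative Lebesgue integrable `ξ` with `∫ g(ξ(x)) dμ_c(x) ≤ 1`. -/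
def allocationValue (p : Seminorm ℝ (Fin d → ℝ)) (φ : ℝ≥0 → ℝ≥0)
    (μ : Measure (Fin d → ℝ)) : ℝ≥0∞ :=
  ⨅ (ξ : (Fin d → ℝ) → ℝ≥0) (_ : Measurable ξ) (_ : ∫⁻ x, (ξ x : ℝ≥0∞) < ∞)
    (_ : ∫⁻ x, g p φ (ξ x) ∂(acPart μ) ≤ 1), ∫⁻ x, (ξ x : ℝ≥0∞)

/-- The set `𝓜` of the probability measures `ν` with a Lebesgue density `ξ` such that
`∫ g(I ξ(x)) dμ_c(x) = 1` and `∫ ξ(x) dx = 1`. -/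
def minimizerMeasures (p : Seminorm ℝ (Fin d → ℝ)) (φ : ℝ≥0 → ℝ≥0)
    (μ : Measure (Fin d → ℝ)) : Set (ProbabilityMeasure (Fin d → ℝ)) :=
  {ν | ∃ ξ : (Fin d → ℝ) → ℝ≥0, Measurable ξ ∧
    (ν : Measure (Fin d → ℝ)) = volume.withDensity (fun x => (ξ x : ℝ≥0∞)) ∧
    ∫⁻ x, g p φ ((allocationValue p φ μ).toNNReal * ξ x) ∂(acPart μ) = 1 ∧
    ∫⁻ x, (ξ x : ℝ≥0∞) = 1}

/-- The empirical measure `N⁻¹ ∑_{y ∈ C} δ_y` of a codebook `C` of size `N ≥ 1`. -/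
def empiricalMeasure (N : ℕ+) (C : Finset (Fin d → ℝ)) (hC : C.card = N) :
    ProbabilityMeasure (Fin d → ℝ) :=
  ⟨((N : ℕ) : ℝ≥0∞)⁻¹ • ∑ y ∈ C, Measure.dirac y, ⟨by
    simp only [Measure.smul_apply, Measure.finsetSum_apply, measure_univ, Finset.sum_const, hC,
      smul_eq_mul, nsmul_eq_mul, mul_one]
    exact ENNReal.inv_mul_cancel (by simp) (by simp)⟩⟩

end OrliczQuantization

end

/-! The heart is a local lower bound. Let `ν` be a limit of the empirical measures along an
ultrafilter, in the weak sense that it dominates the limiting masses of compact sets; mass may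
escape to infinity. Let `ξ` be the density of its absolutely continuous part. Near almost every `x`,
a small cube of volume `v` holds asymptotically about `N v ξ(x)` code points at most, so after
rescaling to the unit cube the definition of `g` bounds the mean cost there from below by about `g(I
ξ(x))`. Code points outside the cube are harmless: a sparse grid, added at the price of a density
`ε`, keeps nearest neighbours close. The costs weighted by the density of `μ_c` are measures of mass
at most `1`; differentiating their limit gives the bound pointwise, hence in integrated form
(`setLIntegral_ball_g_le`). Continuity of `g` removes `ε`, so `∫ g(I ξ) dμ_c ≤ 1`
(`lintegral_g_rnDeriv_le_one`).

Thus `I ξ` satisfies the constraint, and minimality of `I` forces `∫ ξ ≥ 1`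
(`one_le_lintegral_of_lintegral_g_le`). Hence no mass escapes, which is tightness, and no limit has
a singular part. The constraint is active, since otherwise `ξ` could be lowered slightly
(`one_le_lintegral_g`). If `g` is strictly convex, the midpoint of two solutions that differ on a
set charged by `μ_c` would leave slack in the constraint. So the solution is unique, and tightness
turns uniqueness of accumulation points into convergence. -/

noncomputable section

namespace OrliczQuantization

variable {d : ℕ}

section

/-! ### Limits of measures along an ultrafilter -/

/-- Measures of uniformly bounded mass have, along an ultrafilter, a limit that dominates the limit
of the masses of every compact set and has no more mass than the compact sets retain. -/
theorem exists_measure_limit_ultrafilter {ι E : Type*} [TopologicalSpace E] [T2Space E]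
    [MeasurableSpace E] [BorelSpace E] (𝒰 : Ultrafilter ι)
    (m : ι → Measure E) (a : ℝ≥0)
    (ha : ∀ K : Set E, IsCompact K → ∀ᶠ i in (𝒰 : Filter ι), m i K ≤ a) :
    ∃ ν : Measure E, ν univ ≤ a ∧ ∀ K : Set E, IsCompact K →
      limsup (fun i => m i K) (𝒰 : Filter ι) ≤ ν K := by
  -- Since `[0, ∞]` is compact, all masses converge along `𝒰`. The limits on compact sets form a
  -- content, and the measure it induces dominates it on compact sets.
  have hlim : ∀ f : ι → ℝ≥0∞, ∃ l, Tendsto f 𝒰 (𝓝 l) := fun f =>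
    ⟨_, (Ultrafilter.map f 𝒰).le_nhds_lim⟩
  choose l hl using fun K : TopologicalSpace.Compacts E => hlim fun i => m i K
  have hla : ∀ K, l K ≤ a := fun K => le_of_tendsto (hl K) (ha K K.isCompact)
  have hlt : ∀ K, l K ≠ ∞ := fun K => ne_top_of_le_ne_top ENNReal.coe_ne_top (hla K)
  let c : Content E :=
    { toFun := fun K => (l K).toNNReal
      mono' := fun K₁ K₂ h => ENNReal.toNNReal_mono (hlt _)
        (le_of_tendsto_of_tendsto' (hl K₁) (hl K₂) fun i => measure_mono h)
      sup_disjoint' := fun K₁ K₂ h _ h₂ => by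
        rw [← ENNReal.toNNReal_add (hlt _) (hlt _)]
        congr 1
        refine tendsto_nhds_unique (hl _) (((hl K₁).add (hl K₂)).congr fun i => ?_)
        rw [TopologicalSpace.Compacts.coe_sup, measure_union h h₂.measurableSet]
      sup_le' := fun K₁ K₂ => by
        rw [← ENNReal.toNNReal_add (hlt _) (hlt _)]
        refine ENNReal.toNNReal_mono (ENNReal.add_ne_top.2 ⟨hlt _, hlt _⟩) ?_
        refine le_of_tendsto_of_tendsto' (hl _) ((hl K₁).add (hl K₂)) fun i => ?_
        rw [TopologicalSpace.Compacts.coe_sup]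
        exact measure_union_le _ _ }
  have hc : ∀ K, c K = l K := fun K => ENNReal.coe_toNNReal (hlt K)
  refine ⟨c.measure, ?_, fun K hK => ?_⟩
  · rw [Content.measure_apply _ MeasurableSet.univ, c.outerMeasure_of_isOpen univ isOpen_univ]
    refine iSup₂_le fun K _ => ?_
    rw [hc]; exact hla K
  · rw [Content.measure_apply _ hK.measurableSet]
    refine (hl ⟨K, hK⟩).limsup_eq.trans_le ?_
    rw [← hc]
    exact c.le_outerMeasure_compacts ⟨K, hK⟩

/-! ### Norms and distances to codebooks -/

/-- Balls of the sup norm are cubes, so all localization uses `‖·‖`; this bound and its converse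
below transfer the estimates to `p`. -/
theorem exists_seminorm_le_mul_norm (p : Seminorm ℝ (Fin d → ℝ)) :
    ∃ A : ℝ, 0 < A ∧ ∀ x, p x ≤ A * ‖x‖ := by
  refine ⟨∑ i, p (Pi.single i 1) + 1, by positivity, fun x => ?_⟩
  have h : p x ≤ ∑ i, p (Pi.single i (x i)) := by
    conv_lhs => rw [← Finset.univ_sum_single x]
    exact Finset.le_sum_of_subadditive p (map_zero p).le (map_add_le_add p) _ _
  refine h.trans ?_
  rw [add_mul, Finset.sum_mul]
  refine (Finset.sum_le_sum fun i _ => ?_).trans (le_add_of_nonneg_right (by positivity))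
  have : (Pi.single i (x i) : Fin d → ℝ) = x i • Pi.single i 1 := by
    ext j; by_cases hj : j = i <;> simp [hj]
  rw [this, map_smul_eq_mul, mul_comm]
  exact mul_le_mul_of_nonneg_left (norm_le_pi_norm x i) (apply_nonneg p _)

theorem continuous_seminorm (p : Seminorm ℝ (Fin d → ℝ)) : Continuous p := by
  obtain ⟨A, hA, h⟩ := exists_seminorm_le_mul_norm p
  refine Seminorm.continuous_of_continuousAt_zero ?_
  rw [ContinuousAt, map_zero]
  refine squeeze_zero (fun x => apply_nonneg p x) h ?_
  have : Continuous fun x : Fin d → ℝ => A * ‖x‖ := by fun_prop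
  simpa using this.tendsto 0

theorem exists_norm_le_mul_seminorm (p : Seminorm ℝ (Fin d → ℝ)) (hp : ∀ x, p x = 0 → x = 0) :
    ∃ B : ℝ, 0 < B ∧ ∀ x, ‖x‖ ≤ B * p x := by
  rcases (Metric.sphere (0 : Fin d → ℝ) 1).eq_empty_or_nonempty with he | hne
  · refine ⟨1, one_pos, fun x => ?_⟩
    rcases eq_or_ne x 0 with rfl | hx
    · simp
    · have : ‖x‖⁻¹ • x ∈ Metric.sphere (0 : Fin d → ℝ) 1 := by
        simp [norm_smul, hx]
      rw [he] at this
      exact this.elim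
  · obtain ⟨x₀, hx₀, hmin⟩ := (isCompact_sphere (0 : Fin d → ℝ) 1).exists_isMinOn hne
      (continuous_seminorm p).continuousOn
    have hx₀' : 0 < p x₀ := by
      refine lt_of_le_of_ne (apply_nonneg p _) fun h => ?_
      have := hp _ h.symm
      simp [this] at hx₀
    refine ⟨(p x₀)⁻¹, inv_pos.2 hx₀', fun x => ?_⟩
    rcases eq_or_ne x 0 with rfl | hx
    · simp
    have hx' : 0 < ‖x‖ := norm_pos_iff.2 hx
    have h1 : p x₀ ≤ p (‖x‖⁻¹ • x) := hmin (by simp [norm_smul, hx])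
    rw [map_smul_eq_mul, norm_inv, norm_norm] at h1
    rw [inv_mul_eq_div, le_div_iff₀ hx₀']
    rw [inv_mul_eq_div, le_div_iff₀ hx'] at h1
    linarith [mul_comm ‖x‖ (p x₀)]

variable {p : Seminorm ℝ (Fin d → ℝ)} {C D : Finset (Fin d → ℝ)} {x y : Fin d → ℝ}

theorem codebookDist_le (hy : y ∈ C) : (codebookDist p C x : ℝ) ≤ p (x - y) := by
  have : codebookDist p C x ≤ (p (x - y)).toNNReal :=
    ciInf_le (OrderBot.bddBelow _) (⟨y, hy⟩ : C)
  have h := NNReal.coe_le_coe.2 this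
  rwa [Real.coe_toNNReal _ (apply_nonneg p _)] at h

theorem exists_codebookDist_eq (hC : C.Nonempty) (x : Fin d → ℝ) :
    ∃ y ∈ C, (codebookDist p C x : ℝ) = p (x - y) := by
  have : Nonempty C := hC.to_subtype
  obtain ⟨y, hy⟩ := exists_eq_ciInf_of_finite (f := fun y : C => (p (x - y)).toNNReal)
  refine ⟨y, y.2, ?_⟩
  rw [codebookDist, ← hy, Real.coe_toNNReal _ (apply_nonneg p _)]

theorem le_codebookDist (hC : C.Nonempty) {a : ℝ} (h : ∀ y ∈ C, a ≤ p (x - y)) :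
    a ≤ codebookDist p C x := by
  obtain ⟨y, hy, he⟩ := exists_codebookDist_eq (p := p) hC x
  exact he ▸ h y hy

theorem codebookDist_anti (hC : C.Nonempty) (h : C ⊆ D) (x : Fin d → ℝ) :
    codebookDist p D x ≤ codebookDist p C x :=
  NNReal.coe_le_coe.1 (le_codebookDist hC fun _ hy => codebookDist_le (h hy))

theorem codebookDist_image_affine (hC : C.Nonempty) {s : ℝ} (hs : 0 ≤ s) (a u : Fin d → ℝ) :
    (codebookDist p (C.image fun y => a + s • y) (a + s • u) : ℝ) = s * codebookDist p C u := by
  have key : ∀ y, p (a + s • u - (a + s • y)) = s * p (u - y) := fun y => by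
    rw [add_sub_add_left_eq_sub, ← smul_sub, map_smul_eq_mul, Real.norm_of_nonneg hs]
  apply le_antisymm
  · obtain ⟨y, hy, he⟩ := exists_codebookDist_eq (p := p) hC u
    rw [he, ← key]
    exact codebookDist_le (Finset.mem_image_of_mem _ hy)
  · refine le_codebookDist (hC.image _) fun z hz => ?_
    obtain ⟨y, hy, rfl⟩ := Finset.mem_image.1 hz
    rw [key]
    exact mul_le_mul_of_nonneg_left (codebookDist_le hy) hs

theorem measurable_codebookDist (p : Seminorm ℝ (Fin d → ℝ)) (C : Finset (Fin d → ℝ)) :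
    Measurable (codebookDist p C) := by
  unfold codebookDist
  refine Measurable.iInf fun y => ?_
  have := continuous_seminorm p
  fun_prop

theorem measurable_cost {φ : ℝ≥0 → ℝ≥0} (hφ : Monotone φ) (p : Seminorm ℝ (Fin d → ℝ)) (c : ℝ≥0)
    (C : Finset (Fin d → ℝ)) :
    Measurable fun x => (φ (c * codebookDist p C x) : ℝ≥0∞) :=
  (hφ.measurable.comp ((measurable_codebookDist p C).const_mul c)).coe_nnreal_ennreal

/-- Change of variables for the affine maps `u ↦ a + s • u`. -/
theorem setLIntegral_image_affine (f : (Fin d → ℝ) → ℝ≥0∞) {s : ℝ} (hs : 0 < s) (a : Fin d → ℝ)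
    (S : Set (Fin d → ℝ)) :
    ∫⁻ y in (fun u => a + s • u) '' S, f y =
      ENNReal.ofReal (s ^ d) * ∫⁻ u in S, f (a + s • u) := by
  let e : (Fin d → ℝ) ≃ᵐ (Fin d → ℝ) :=
    (MeasurableEquiv.smul₀ s hs.ne').trans (MeasurableEquiv.addLeft a)
  have he : ∀ u, e u = a + s • u := fun u => rfl
  have hmap : Measure.map e volume = ENNReal.ofReal ((s ^ d)⁻¹) • volume := by
    have h1 : Measure.map (fun u : Fin d → ℝ => s • u) volume =
        ENNReal.ofReal ((s ^ d)⁻¹) • volume := by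
      have := Measure.map_addHaar_smul (volume : Measure (Fin d → ℝ)) hs.ne'
      simp only [Module.finrank_fintype_fun_eq_card, Fintype.card_fin] at this
      rw [abs_of_pos (by positivity)] at this
      exact this
    have h2 : (e : (Fin d → ℝ) → (Fin d → ℝ)) = (fun u => a + u) ∘ fun u => s • u := rfl
    rw [h2, ← Measure.map_map (by fun_prop) (by fun_prop), h1, Measure.map_smul,
      map_add_left_eq_self]
  have hvol : (volume : Measure (Fin d → ℝ)) = ENNReal.ofReal (s ^ d) • Measure.map e volume := by
    rw [hmap, smul_smul, ← ENNReal.ofReal_mul (by positivity), mul_inv_cancel₀ (by positivity)]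
    simp
  have himg : (fun u => a + s • u) '' S = e '' S := rfl
  rw [himg]
  conv_lhs => rw [hvol, Measure.restrict_smul, lintegral_smul_measure]
  rw [MeasurableEquiv.restrict_map, lintegral_map_equiv, e.preimage_image, smul_eq_mul]
  rfl

end

section

/-! ### Regular grids -/

/-- The grid of the points `ℓ z`, where `z` is an integer vector with entries in `[a, b)`. -/
def grid (d : ℕ) (ℓ : ℝ) (a b : ℤ) : Finset (Fin d → ℝ) :=
  (Fintype.piFinset fun _ : Fin d => Finset.Ico a b).image fun z i => ℓ * z i

theorem card_grid_le (ℓ : ℝ) (a b : ℤ) : (grid d ℓ a b).card ≤ (b - a).toNat ^ d :=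
  Finset.card_image_le.trans (by simp)

theorem exists_mem_grid {ℓ : ℝ} (hℓ : 0 < ℓ) {a b : ℤ} {x : Fin d → ℝ}
    (h : ∀ i, a * ℓ ≤ x i ∧ x i < b * ℓ) : ∃ y ∈ grid d ℓ a b, ‖x - y‖ ≤ ℓ := by
  refine ⟨fun i => ℓ * ⌊x i / ℓ⌋, Finset.mem_image.2 ⟨fun i => ⌊x i / ℓ⌋, ?_, rfl⟩, ?_⟩
  · rw [Fintype.mem_piFinset]
    intro i
    rw [Finset.mem_Ico, Int.le_floor, Int.floor_lt, le_div_iff₀ hℓ, div_lt_iff₀ hℓ]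
    exact h i
  · refine (pi_norm_le_iff_of_nonneg hℓ.le).2 fun i => ?_
    have h1 : x i - ℓ * ⌊x i / ℓ⌋ = ℓ * Int.fract (x i / ℓ) := by
      rw [Int.fract, mul_sub, mul_div_cancel₀ _ hℓ.ne']
    rw [Pi.sub_apply, h1, Real.norm_of_nonneg (mul_nonneg hℓ.le (Int.fract_nonneg _))]
    exact mul_le_of_le_one_right hℓ.le (Int.fract_lt_one _).le

/-- Each coordinate admits at most `2r/ℓ + 1` multiples of `ℓ`; the condition `ℓ ≤ 2r` absorbs the
`1`. -/
theorem card_grid_filter_closedBall_le {ℓ r : ℝ} (hℓ : 0 < ℓ) (hr : ℓ ≤ 2 * r) (a b : ℤ)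
    (x : Fin d → ℝ) [DecidablePred (· ∈ Metric.closedBall x r)] :
    (((grid d ℓ a b).filter (· ∈ Metric.closedBall x r)).card : ℝ) ≤ (4 * r / ℓ) ^ d := by
  have hr0 : 0 ≤ r := by linarith
  have hsub : (grid d ℓ a b).filter (· ∈ Metric.closedBall x r) ⊆
      (Fintype.piFinset fun i : Fin d =>
        Finset.Icc ⌈(x i - r) / ℓ⌉ ⌊(x i + r) / ℓ⌋).image fun z i => ℓ * z i := by
    intro y hy
    rw [Finset.mem_filter] at hy
    obtain ⟨z, -, rfl⟩ := Finset.mem_image.1 hy.1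
    refine Finset.mem_image.2 ⟨z, ?_, rfl⟩
    rw [Fintype.mem_piFinset]
    intro i
    have h := (dist_pi_le_iff hr0).1 (Metric.mem_closedBall.1 hy.2) i
    rw [Real.dist_eq, abs_le] at h
    rw [Finset.mem_Icc, Int.ceil_le, Int.le_floor, le_div_iff₀ hℓ, div_le_iff₀ hℓ]
    constructor <;> linarith [h.1, h.2, mul_comm ℓ (z i : ℝ)]
  have hcard := (Finset.card_le_card hsub).trans Finset.card_image_le
  rw [Fintype.card_piFinset] at hcard
  refine (Nat.cast_le.2 hcard).trans ?_
  rw [Nat.cast_prod]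
  refine (Finset.prod_le_prod (fun _ _ => Nat.cast_nonneg _) fun i _ => ?_).trans_eq
    (b := ∏ _i : Fin d, 4 * r / ℓ) (by simp [div_pow])
  rw [Int.card_Icc]
  have h1 : (1 : ℝ) ≤ 2 * r / ℓ := by rwa [le_div_iff₀ hℓ, one_mul]
  have h2 : 4 * r / ℓ = 2 * r / ℓ + 2 * r / ℓ := by ring
  have h3 : (x i + r) / ℓ = (x i - r) / ℓ + 2 * r / ℓ := by ring
  have h4 := Int.floor_le ((x i + r) / ℓ)
  have h5 := Int.le_ceil ((x i - r) / ℓ)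
  have h6 : (((⌊(x i + r) / ℓ⌋ + 1 - ⌈(x i - r) / ℓ⌉).toNat : ℤ) : ℝ) ≤ 4 * r / ℓ := by
    rw [Int.toNat_eq_max]
    push_cast
    exact max_le (by linarith) (by linarith)
  exact_mod_cast h6

/-! ### The function `g` -/

/-- The expected cost `𝔼 φ(c d(U, C))` of a codebook for the uniform distribution on the cube. -/
def cubeCost (p : Seminorm ℝ (Fin d → ℝ)) (φ : ℝ≥0 → ℝ≥0) (c : ℝ≥0) (C : Finset (Fin d → ℝ)) :
    ℝ≥0∞ :=
  ∫⁻ x in unitCube d, (φ (c * codebookDist p C x) : ℝ≥0∞)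

theorem volume_unitCube : volume (unitCube d) = 1 := by
  simp [unitCube, Real.volume_pi_Ico]

theorem measurableSet_unitCube : MeasurableSet (unitCube d) :=
  MeasurableSet.univ_pi fun _ => measurableSet_Ico

variable {p : Seminorm ℝ (Fin d → ℝ)} {φ : ℝ≥0 → ℝ≥0}

theorem cubeCost_anti (hφ : Monotone φ) (c : ℝ≥0) {C D : Finset (Fin d → ℝ)} (hC : C.Nonempty)
    (h : C ⊆ D) : cubeCost p φ c D ≤ cubeCost p φ c C :=
  lintegral_mono fun x => ENNReal.coe_le_coe.2 <| hφ <|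
    mul_le_mul_right (codebookDist_anti hC h x) c

theorem cubeCost_le (hφ : Monotone φ) (c : ℝ≥0) {C : Finset (Fin d → ℝ)} {K : ℝ≥0}
    (h : ∀ x ∈ unitCube d, c * codebookDist p C x ≤ K) : cubeCost p φ c C ≤ φ K := by
  refine (setLIntegral_mono' measurableSet_unitCube fun x hx =>
    ENNReal.coe_le_coe.2 (hφ (h x hx))).trans ?_
  simp [volume_unitCube]

/-- A codebook of at most `η c ^ d` points bounds `g η`. -/
theorem gPos_le_cubeCost (hd : 0 < d) (hφ : Monotone φ) {η c : ℝ≥0} (hη : 0 < η)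
    {C : Finset (Fin d → ℝ)} (hC : C.Nonempty) (hcard : (C.card : ℝ≥0) ≤ η * c ^ d) :
    gPos p φ η ≤ cubeCost p φ c C := by
  have : Nonempty (Fin d) := ⟨⟨0, hd⟩⟩
  have h1 : (1 : ℝ≥0) ≤ η * c ^ d := le_trans (by exact_mod_cast hC.card_pos) hcard
  -- The real parameter `N = η c ^ d` makes `(N/η)^{1/d} = c`. Padding `C` to exactly `⌊N⌋` points
  -- only lowers the cost.
  obtain ⟨D, hCD, hD⟩ := Infinite.exists_superset_card_eq C ⌊η * c ^ d⌋₊ (Nat.le_floor hcard)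
  refine (iInf₂_le (η * c ^ d) h1).trans ((iInf₂_le D hD).trans ?_)
  rw [mul_div_cancel_left₀ _ hη.ne', one_div, NNReal.pow_rpow_inv_natCast _ hd.ne']
  exact cubeCost_anti hφ c hC hCD

/-- Together with `gPos_le_cubeCost` this replaces the infimum over `N` and exact sizes by pairs
`(c, C)` subject only to an upper bound on the size, a form that is stable under scaling and tiling.
-/
theorem exists_cubeCost_lt (hd : 0 < d) {η : ℝ≥0} (hη : 0 < η) {b : ℝ≥0∞} (hb : gPos p φ η < b) :
    ∃ (c : ℝ≥0) (C : Finset (Fin d → ℝ)), C.Nonempty ∧ (C.card : ℝ≥0) ≤ η * c ^ d ∧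
      cubeCost p φ c C < b := by
  simp only [gPos, uniformError, iInf_lt_iff] at hb
  obtain ⟨N, hN, C, hC, h⟩ := hb
  refine ⟨(N / η) ^ (1 / (d : ℝ)), C, ?_, ?_, h⟩
  · rw [← Finset.card_pos, hC]
    exact Nat.floor_pos.2 hN
  · rw [one_div, NNReal.rpow_inv_natCast_pow _ hd.ne', mul_div_cancel₀ _ hη.ne', hC]
    exact Nat.floor_le zero_le

theorem gPos_anti (hd : 0 < d) (hφ : Monotone φ) {η η' : ℝ≥0} (hη : 0 < η) (h : η ≤ η') :
    gPos p φ η' ≤ gPos p φ η := by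
  refine le_of_forall_gt fun b hb => ?_
  obtain ⟨c, C, hC, hcard, hc⟩ := exists_cubeCost_lt hd hη hb
  exact (gPos_le_cubeCost hd hφ (hη.trans_le h) hC (hcard.trans (by gcongr))).trans_lt hc

/-- The cost on a cube of a codebook with at most `η (2 c r) ^ d` points. -/
theorem mul_gPos_le_setLIntegral_closedBall (hd : 0 < d) (hφ : Monotone φ) {η c : ℝ≥0} (hη : 0 < η)
    {r : ℝ} (hr : 0 < r) (x : Fin d → ℝ) {C : Finset (Fin d → ℝ)} (hC : C.Nonempty)
    (hcard : (C.card : ℝ) ≤ η * (c * (2 * r)) ^ d) :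
    ENNReal.ofReal ((2 * r) ^ d) * gPos p φ η ≤
      ∫⁻ y in Metric.closedBall x r, (φ (c * codebookDist p C y) : ℝ≥0∞) := by
  have h2r : 0 < 2 * r := by positivity
  -- The closed ball is a cube of side `2r` with lower corner `a`; pulling `C` back to the unit cube
  -- multiplies the scale `c` by `2r`.
  set a : Fin d → ℝ := fun i => x i - r with ha
  have himg : (fun u => a + (2 * r) • u) '' unitCube d ⊆ Metric.closedBall x r := by
    rintro _ ⟨u, hu, rfl⟩
    rw [Metric.mem_closedBall, dist_pi_le_iff hr.le]
    intro i
    have hi := hu i (mem_univ i)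
    rw [Real.dist_eq, abs_le]
    simp only [ha, Pi.add_apply, Pi.smul_apply, smul_eq_mul]
    constructor <;> nlinarith [hi.1, hi.2]
  refine le_trans ?_ (lintegral_mono_set himg)
  rw [setLIntegral_image_affine _ h2r]
  refine mul_le_mul_right ?_ _
  set D : Finset (Fin d → ℝ) := C.image fun y => (2 * r)⁻¹ • (y - a) with hD
  have hDC : D.image (fun u => a + (2 * r) • u) = C := by
    rw [hD, Finset.image_image]
    have : ((fun u => a + (2 * r) • u) ∘ fun y => (2 * r)⁻¹ • (y - a)) = id := by
      ext1 y
      rw [Function.comp_apply, smul_smul, mul_inv_cancel₀ h2r.ne', one_smul, add_sub_cancel, id]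
    rw [this, Finset.image_id]
  have hdist : ∀ u, c * codebookDist p C (a + (2 * r) • u) =
      c * (2 * r).toNNReal * codebookDist p D u := fun u => by
    apply NNReal.eq
    conv_lhs => rw [← hDC]
    rw [NNReal.coe_mul, codebookDist_image_affine (hC.image _) h2r.le, NNReal.coe_mul,
      NNReal.coe_mul, Real.coe_toNNReal _ h2r.le, ← mul_assoc]
  simp only [hdist]
  refine gPos_le_cubeCost hd hφ hη (hC.image _) ?_
  rw [← NNReal.coe_le_coe]
  push_cast
  rw [Real.coe_toNNReal _ h2r.le]
  exact (Nat.cast_le.2 Finset.card_image_le).trans hcard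

/-- Codebooks for the `k ^ d` subcubes of side `1 / k` combine to a codebook for the cube. -/
theorem exists_cubeCost_tiling_le (hφ : Monotone φ) (c : ℝ≥0) {k : ℕ} (hk : 0 < k)
    (D : (Fin d → Fin k) → Finset (Fin d → ℝ)) (hD : ∀ i, (D i).Nonempty) :
    ∃ C : Finset (Fin d → ℝ), C.Nonempty ∧ C.card ≤ ∑ i, (D i).card ∧
      cubeCost p φ (c * k) C ≤ ENNReal.ofReal ((k : ℝ)⁻¹ ^ d) * ∑ i, cubeCost p φ c (D i) := by
  have hk' : (0 : ℝ) < (k : ℝ)⁻¹ := by positivity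
  let a : (Fin d → Fin k) → (Fin d → ℝ) := fun i j => (k : ℝ)⁻¹ * (i j : ℕ)
  let T : (Fin d → Fin k) → (Fin d → ℝ) → (Fin d → ℝ) := fun i u => a i + (k : ℝ)⁻¹ • u
  let C : Finset (Fin d → ℝ) := Finset.univ.biUnion fun i => (D i).image (T i)
  have hsub : ∀ i, (D i).image (T i) ⊆ C := fun i =>
    Finset.subset_biUnion_of_mem (fun i => (D i).image (T i)) (Finset.mem_univ i)
  have hcover : unitCube d ⊆ ⋃ i, T i '' unitCube d := by
    intro x hx
    have hx' : ∀ j, 0 ≤ x j ∧ x j < 1 := fun j => hx j (mem_univ j)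
    have hkpos : (0 : ℝ) < k := by positivity
    have hlt : ∀ j, ⌊k * x j⌋₊ < k := fun j => by
      rw [Nat.floor_lt (mul_nonneg hkpos.le (hx' j).1)]
      nlinarith [(hx' j).2]
    -- The integer parts of `k x` select the subcube, the fractional parts the position in it.
    refine mem_iUnion.2 ⟨fun j => ⟨⌊k * x j⌋₊, hlt j⟩, fun j => k * x j - ⌊k * x j⌋₊, ?_, ?_⟩
    · intro j _
      have h1 := Nat.floor_le (mul_nonneg hkpos.le (hx' j).1)
      have h2 := Nat.lt_floor_add_one (k * x j)
      constructor <;> linarith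
    · ext j
      simp only [T, a, Pi.add_apply, Pi.smul_apply, smul_eq_mul]
      field_simp
      ring
  have hCne : C.Nonempty := by
    have : Nonempty (Fin d → Fin k) := ⟨fun _ => ⟨0, hk⟩⟩
    exact (((hD (Classical.arbitrary _)).image _)).mono (hsub _)
  refine ⟨C, hCne, ?_, ?_⟩
  · exact Finset.card_biUnion_le.trans (Finset.sum_le_sum fun i _ => Finset.card_image_le)
  · calc cubeCost p φ (c * k) C
        ≤ ∫⁻ x in ⋃ i, T i '' unitCube d, (φ (c * k * codebookDist p C x) : ℝ≥0∞) :=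
          lintegral_mono_set hcover
      _ ≤ ∑' i, ∫⁻ x in T i '' unitCube d, (φ (c * k * codebookDist p C x) : ℝ≥0∞) :=
          lintegral_iUnion_le _ _
      _ = ∑ i, ∫⁻ x in T i '' unitCube d, (φ (c * k * codebookDist p C x) : ℝ≥0∞) :=
          tsum_fintype _
      _ ≤ ∑ i, ENNReal.ofReal ((k : ℝ)⁻¹ ^ d) * cubeCost p φ c (D i) := by
          refine Finset.sum_le_sum fun i _ => ?_
          rw [setLIntegral_image_affine _ hk']
          refine mul_le_mul_right (lintegral_mono fun u => ENNReal.coe_le_coe.2 (hφ ?_)) _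
          refine (mul_le_mul_right (codebookDist_anti ((hD i).image _) (hsub i) _) _).trans_eq ?_
          apply NNReal.eq
          rw [NNReal.coe_mul, codebookDist_image_affine (hD i) hk'.le]
          push_cast
          field_simp
      _ = _ := by rw [Finset.mul_sum]

/-- The grid has spacing `1/m` with `m = ⌊tc⌋`. As `tc ≥ 1`, rounding loses at most a factor `2`, so
the scaled distance is at most `cA/m ≤ 2A/t`, independently of `c`. -/
theorem exists_grid_cubeCost_le (hφ : Monotone φ) {A : ℝ} (hA : 0 < A)
    (hpA : ∀ x, p x ≤ A * ‖x‖) {t c : ℝ≥0} (h : 1 ≤ t * c) :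
    ∃ G : Finset (Fin d → ℝ), G.Nonempty ∧ (G.card : ℝ≥0) ≤ (t * c) ^ d ∧
      cubeCost p φ c G ≤ φ (2 * A.toNNReal / t) := by
  set m := ⌊t * c⌋₊ with hm
  have hm1 : 1 ≤ m := Nat.le_floor (by simpa using h)
  have hmle : (m : ℝ≥0) ≤ t * c := Nat.floor_le zero_le
  have hmlt : t * c ≤ 2 * m := by
    have h1 : t * c < m + 1 := Nat.lt_floor_add_one _
    have h2 : (1 : ℝ≥0) ≤ m := by exact_mod_cast hm1
    calc t * c ≤ m + 1 := h1.le
      _ ≤ m + m := by gcongr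
      _ = 2 * m := by ring
  have ht : 0 < t := by
    rcases eq_or_ne t 0 with rfl | h0
    · simp at h
    · exact pos_iff_ne_zero.2 h0
  have hm0 : (0 : ℝ) < (m : ℝ)⁻¹ := by positivity
  have hcov : ∀ x ∈ unitCube d, ∃ y ∈ grid d (m : ℝ)⁻¹ 0 m, ‖x - y‖ ≤ (m : ℝ)⁻¹ := fun x hx => by
    refine exists_mem_grid hm0 fun i => ?_
    have := hx i (mem_univ i)
    have hm0 : (m : ℝ) ≠ 0 := by positivity
    simpa [hm0] using this
  refine ⟨grid d (m : ℝ)⁻¹ 0 m, ?_, ?_, cubeCost_le hφ _ fun x hx => ?_⟩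
  · obtain ⟨y, hy, -⟩ := hcov 0 fun i _ => by simp
    exact ⟨y, hy⟩
  · refine (Nat.cast_le.2 (card_grid_le _ _ _)).trans ?_
    simp only [sub_zero, Int.toNat_natCast, Nat.cast_pow]
    gcongr
  · obtain ⟨y, hy, hxy⟩ := hcov x hx
    rw [← NNReal.coe_le_coe]
    push_cast
    rw [Real.coe_toNNReal _ hA.le]
    have h1 : (codebookDist p (grid d (m : ℝ)⁻¹ 0 m) x : ℝ) ≤ A * (m : ℝ)⁻¹ :=
      (codebookDist_le hy).trans ((hpA _).trans (by gcongr))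
    have h2 : (t : ℝ) * c ≤ 2 * m := by exact_mod_cast hmlt
    have ht' : (0 : ℝ) < t := ht
    have hm' : (0 : ℝ) < m := by positivity
    calc (c : ℝ) * codebookDist p (grid d (m : ℝ)⁻¹ 0 m) x ≤ c * (A * (m : ℝ)⁻¹) := by gcongr
      _ ≤ 2 * A / t := by
        rw [le_div_iff₀ ht', ← div_eq_mul_inv, mul_div_assoc', div_mul_eq_mul_div, div_le_iff₀ hm']
        nlinarith

/-! ### Continuity of `g` on `[0, ∞)` -/

theorem sum_apply_ite_mem {ι β M : Type*} [Fintype ι] [DecidableEq ι] [AddCommMonoid M]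
    (S : Finset ι) (F : β → M) (a b : β) :
    ∑ i, F (if i ∈ S then a else b) = S.card • F a + Sᶜ.card • F b := by
  rw [← Finset.sum_add_sum_compl S, ← Finset.sum_const, ← Finset.sum_const]
  congr 1 <;> refine Finset.sum_congr rfl fun i hi => ?_
  · rw [if_pos hi]
  · rw [if_neg (Finset.mem_compl.1 hi)]

/-- Lowering the density by a small fraction raises `g` by a proportional amount only. -/
theorem exists_gPos_le_add (hd : 0 < d) (hφ : Monotone φ) (p : Seminorm ℝ (Fin d → ℝ)) {η₀ : ℝ≥0}
    (hη₀ : 0 < η₀) :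
    ∃ K : ℝ≥0, ∀ η η' δ : ℝ≥0, η₀ ≤ η → 0 < η' → 0 < δ → δ ≤ 1 / 2 → η ≤ η' + δ * η →
      gPos p φ η' ≤ gPos p φ η + δ * K := by
  obtain ⟨A, hA, hpA⟩ := exists_seminorm_le_mul_norm p
  refine ⟨3 * φ (2 * A.toNNReal / (η₀ / 2) ^ (1 / (d : ℝ))),
    fun η η' δ hη hη' hδ hδ2 hηδ => ?_⟩
  have hηpos : 0 < η := hη₀.trans_le hη
  -- The cube is tiled by copies of a nearly optimal codebook, and in a small fraction of the tiles
  -- this is replaced by a grid of half the density, which saves points at bounded cost.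
  set t : ℝ≥0 := (η / 2) ^ (1 / (d : ℝ)) with ht
  have htd : t ^ d = η / 2 := by
    rw [ht, one_div, NNReal.rpow_inv_natCast_pow _ hd.ne']
  have hK : φ (2 * A.toNNReal / t) ≤ φ (2 * A.toNNReal / (η₀ / 2) ^ (1 / (d : ℝ))) := by
    refine hφ ?_
    have : 0 < (η₀ / 2) ^ (1 / (d : ℝ)) := NNReal.rpow_pos (by positivity)
    rw [ht]
    gcongr
  refine ENNReal.le_of_forall_pos_le_add fun ε hε hfin => ?_
  have hgfin : gPos p φ η ≠ ∞ := ((le_add_right le_rfl).trans_lt hfin).ne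
  obtain ⟨c₀, C₀, hC₀, hcard₀, hcost₀⟩ := exists_cubeCost_lt hd hηpos
    (ENNReal.lt_add_right hgfin (ENNReal.coe_ne_zero.2 hε.ne'))
  -- Passing to `2 ^ d` copies doubles the scale without changing density or cost bound, so that
  -- even half the density leaves room for a grid point.
  obtain ⟨C, hC, hcard, hcost⟩ := exists_cubeCost_tiling_le (p := p) hφ c₀ two_pos
    (fun _ : Fin d → Fin 2 => C₀) fun _ => hC₀
  set c : ℝ≥0 := c₀ * (2 : ℕ) with hc
  have hcd : c ^ d = 2 ^ d * c₀ ^ d := by rw [hc]; push_cast; ring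
  have hcard' : (C.card : ℝ≥0) ≤ η * c ^ d := by
    have h1 : C.card ≤ 2 ^ d * C₀.card := by simpa using hcard
    calc (C.card : ℝ≥0) ≤ 2 ^ d * C₀.card := by exact_mod_cast h1
      _ ≤ 2 ^ d * (η * c₀ ^ d) := by gcongr
      _ = η * c ^ d := by rw [hcd]; ring
  have hcost' : cubeCost p φ c C ≤ gPos p φ η + ε := by
    refine hcost.trans (le_trans ?_ hcost₀.le)
    rw [Finset.sum_const, Finset.card_univ, Fintype.card_pi_const, nsmul_eq_mul, ← mul_assoc,
      Fintype.card_fin, inv_pow, ENNReal.ofReal_inv_of_pos (by positivity)]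
    refine (mul_le_of_le_one_left (zero_le) ?_)
    rw [ENNReal.ofReal_pow (by positivity), ENNReal.ofReal_natCast]
    push_cast
    exact ENNReal.inv_mul_le_one _
  have htc : 1 ≤ t * c := by
    have h1 : (1 : ℝ≥0) ≤ η * c₀ ^ d := le_trans (by exact_mod_cast hC₀.card_pos) hcard₀
    have h2 : (2 : ℝ≥0) ≤ 2 ^ d := le_self_pow₀ one_le_two hd.ne'
    rw [← one_le_pow_iff_of_nonneg zero_le hd.ne', mul_pow, htd, hcd]
    calc (1 : ℝ≥0) = 2 * 1 / 2 := by simp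
      _ ≤ 2 ^ d * (η * c₀ ^ d) / 2 := by gcongr
      _ = η / 2 * (2 ^ d * c₀ ^ d) := by ring
  obtain ⟨G, hG, hGcard, hGcost⟩ := exists_grid_cubeCost_le (p := p) hφ hA hpA htc
  rw [mul_pow, htd] at hGcard
  -- This many tiles give `δ n ≥ 1`, so rounding `2δn` up to `j` costs at most another `δn`; hence
  -- the factor `3` in the constant.
  set k := ⌈δ⁻¹⌉₊ with hk
  have hk0 : 0 < k := Nat.ceil_pos.2 (inv_pos.2 hδ)
  set n := k ^ d with hn
  have hn0 : 0 < n := pow_pos hk0 d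
  have hδn : 1 ≤ δ * n := by
    have h1 : δ⁻¹ ≤ n := (Nat.le_ceil _).trans (by exact_mod_cast Nat.le_self_pow hd.ne' k)
    calc (1 : ℝ≥0) = δ * δ⁻¹ := (mul_inv_cancel₀ hδ.ne').symm
      _ ≤ δ * n := by gcongr
  set j := ⌈2 * δ * n⌉₊ with hj
  have hjn : j ≤ n := by
    refine Nat.ceil_le.2 (mul_le_of_le_one_left zero_le ?_)
    calc 2 * δ ≤ 2 * (1 / 2) := by gcongr
      _ = 1 := by simp
  have hj1 : 2 * δ * n ≤ j := Nat.le_ceil _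
  have hj2 : (j : ℝ≥0) ≤ 3 * δ * n := by
    refine (Nat.ceil_lt_add_one zero_le).le.trans ?_
    calc 2 * δ * n + 1 ≤ 2 * δ * n + δ * n := by gcongr
      _ = 3 * δ * n := by ring
  have hcardtiles : (Finset.univ : Finset (Fin d → Fin k)).card = n := by
    rw [Finset.card_univ, Fintype.card_pi_const, Fintype.card_fin]
  obtain ⟨S, -, hS⟩ := Finset.exists_subset_card_eq (hcardtiles.symm ▸ hjn)
  have hSc : Sᶜ.card = n - j := by rw [Finset.card_compl, ← Finset.card_univ, hcardtiles, hS]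
  obtain ⟨C', hC', hcardC', hcostC'⟩ := exists_cubeCost_tiling_le (p := p) hφ c hk0
    (fun i => if i ∈ S then G else C) fun i => by split_ifs <;> assumption
  have hcardC'' : (C'.card : ℝ≥0) ≤ η' * (c * k) ^ d := by
    rw [sum_apply_ite_mem S Finset.card, hS, hSc, smul_eq_mul, smul_eq_mul] at hcardC'
    have h2 : (C'.card : ℝ) ≤ j * G.card + (n - j) * C.card := by
      rw [← Nat.cast_sub hjn]
      exact_mod_cast hcardC'
    rw [← NNReal.coe_le_coe] at *
    push_cast at *
    refine h2.trans ?_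
    have hX : (0 : ℝ) ≤ c ^ d := by positivity
    have hjn' : (j : ℝ) ≤ n := by exact_mod_cast hjn
    have hkd : ((c : ℝ) * k) ^ d = c ^ d * n := by rw [mul_pow, hn]; push_cast; ring
    rw [hkd]
    -- Each of the `j ≥ 2δn` grid tiles saves `η c ^ d / 2` points, in total at least the fraction
    -- `δ` of `η c ^ d n`.
    have e1 : (j : ℝ) * G.card ≤ j * (η / 2 * c ^ d) := by gcongr
    have e2 : ((n : ℝ) - j) * C.card ≤ (n - j) * (η * c ^ d) :=
      mul_le_mul_of_nonneg_left hcard' (by linarith)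
    have e3 : (η : ℝ) * c ^ d * (2 * δ * n) ≤ η * c ^ d * j := by gcongr
    have e4 : (η : ℝ) * (c ^ d * n) ≤ (η' + δ * η) * (c ^ d * n) := by gcongr
    linarith
  refine (gPos_le_cubeCost hd hφ hη' hC' hcardC'').trans (hcostC'.trans ?_)
  rw [sum_apply_ite_mem S (cubeCost p φ c), hS, hSc, nsmul_eq_mul, nsmul_eq_mul, inv_pow, ENNReal.ofReal_inv_of_pos (by positivity), ENNReal.ofReal_pow (by positivity),
    ENNReal.ofReal_natCast]
  have hnk : ((k : ℝ≥0∞)) ^ d = n := by rw [hn]; push_cast; rfl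
  rw [hnk]
  have hn1 : (n : ℝ≥0∞)⁻¹ * n = 1 := ENNReal.inv_mul_cancel (by simp [hn0.ne']) (by simp)
  set K := φ (2 * A.toNNReal / (η₀ / 2) ^ (1 / (d : ℝ)))
  calc (n : ℝ≥0∞)⁻¹ * (j * cubeCost p φ c G + (n - j : ℕ) * cubeCost p φ c C)
      ≤ (n : ℝ≥0∞)⁻¹ * ((3 * δ * n : ℝ≥0) * K + n * (gPos p φ η + ε)) := by
        gcongr
        · exact_mod_cast hj2
        · exact hGcost.trans (ENNReal.coe_le_coe.2 hK)
        · exact Nat.sub_le _ _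
    _ = ((n : ℝ≥0∞)⁻¹ * n) * (3 * δ * K) + ((n : ℝ≥0∞)⁻¹ * n) * (gPos p φ η + ε) := by
        push_cast; ring
    _ = gPos p φ η + δ * (3 * K : ℝ≥0) + ε := by rw [hn1]; push_cast; ring

/-- At the scale `c = η^{-1/d}` one point is allowed, and the distance to the origin is bounded on
the cube. -/
theorem gPos_lt_top (hd : 0 < d) (hφ : Monotone φ) {η : ℝ≥0} (hη : 0 < η) : gPos p φ η < ∞ := by
  obtain ⟨A, hA, hpA⟩ := exists_seminorm_le_mul_norm p
  set c : ℝ≥0 := η⁻¹ ^ (1 / (d : ℝ)) with hc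
  have hcd : η * c ^ d = 1 := by
    rw [hc, one_div, NNReal.rpow_inv_natCast_pow _ hd.ne', mul_inv_cancel₀ hη.ne']
  refine (gPos_le_cubeCost (C := {0}) (c := c) hd hφ hη (by simp) (by simp [hcd])).trans_lt ?_
  refine (cubeCost_le (K := c * A.toNNReal) hφ _ fun x hx => ?_).trans_lt ENNReal.coe_lt_top
  refine mul_le_mul_right (NNReal.coe_le_coe.1 ?_) _
  rw [Real.coe_toNNReal _ hA.le]
  refine (codebookDist_le (Finset.mem_singleton_self 0)).trans ((hpA _).trans ?_)
  refine mul_le_of_le_one_right hA.le ((pi_norm_le_iff_of_nonneg zero_le_one).2 fun i => ?_)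
  have := hx i (mem_univ i)
  rw [Pi.sub_apply, Pi.zero_apply, sub_zero, Real.norm_of_nonneg this.1]
  exact this.2.le

/-- The estimate of `exists_gPos_le_add` is used in both directions, from `η` to `η'` and back; the
common lower bound `η/2` yields one constant for both. -/
theorem continuousAt_gPos (hd : 0 < d) (hφ : Monotone φ) {η : ℝ≥0} (hη : 0 < η) :
    ContinuousAt (gPos p φ) η := by
  obtain ⟨K, hK⟩ := exists_gPos_le_add hd hφ p (half_pos hη)
  rw [ContinuousAt, ENNReal.tendsto_nhds (gPos_lt_top hd hφ hη).ne]
  intro ε hε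
  obtain ⟨ε', hε', hεε⟩ := ENNReal.lt_iff_exists_nnreal_btwn.1 hε
  have hε'pos : 0 < ε' := by exact_mod_cast hε'
  set δ : ℝ≥0 := min (1 / 2) (ε' / (K + 1)) with hδ
  have hδ0 : 0 < δ := lt_min (by positivity) (by positivity)
  have hδ2 : δ ≤ 1 / 2 := min_le_left _ _
  have hδK : (δ * K : ℝ≥0∞) ≤ ε := by
    refine le_trans ?_ hεε.le
    have : δ * K ≤ ε' := by
      calc δ * K ≤ ε' / (K + 1) * (K + 1) := by
            gcongr
            · exact min_le_right _ _
            · exact le_add_of_nonneg_right zero_le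
        _ = ε' := div_mul_cancel₀ _ (by positivity)
    exact_mod_cast this
  have h1 : ∀ᶠ η' in 𝓝 η, η / 2 < η' := lt_mem_nhds (NNReal.half_lt_self hη.ne')
  have h2 : ∀ᶠ η' in 𝓝 η, η < η' + δ * η :=
    (by fun_prop : Continuous fun η' : ℝ≥0 => η' + δ * η).continuousAt.eventually_const_lt
      (lt_add_of_pos_right _ (by positivity))
  have h3 : ∀ᶠ η' in 𝓝 η, η' < η + δ * η' :=
    ContinuousAt.eventually_lt (f := fun η' => η') (g := fun η' => η + δ * η')
      (by fun_prop) (by fun_prop) (lt_add_of_pos_right _ (by positivity))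
  filter_upwards [h1, h2, h3] with η' h1 h2 h3
  have hη' : 0 < η' := (by positivity : 0 < η / 2).trans h1
  refine ⟨tsub_le_iff_right.2 ?_, ?_⟩
  · exact (hK η' η δ h1.le hη hδ0 hδ2 h3.le).trans (by gcongr)
  · exact (hK η η' δ (half_le_self zero_le) hη' hδ0 hδ2 h2.le).trans (by gcongr)

theorem g_of_pos {η : ℝ≥0} (hη : 0 < η) : g p φ η = gPos p φ η := if_neg hη.ne'

theorem g_anti (hd : 0 < d) (hφ : Monotone φ) : Antitone (g p φ) := by
  intro η η' h
  rcases eq_or_ne η' 0 with rfl | hη'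
  · rw [nonpos_iff_eq_zero.1 h]
  have hη'pos := pos_iff_ne_zero.2 hη'
  rw [g_of_pos hη'pos]
  rcases eq_or_ne η 0 with rfl | hη
  · rw [g, if_pos rfl]
    refine le_liminf_of_le (by isBoundedDefault) ?_
    filter_upwards [Ioo_mem_nhdsGT hη'pos] with t ht
    exact gPos_anti hd hφ ht.1 ht.2.le
  · have hηpos := pos_iff_ne_zero.2 hη
    rw [g_of_pos hηpos]
    exact gPos_anti hd hφ hηpos h

/-- At `0` monotonicity bounds nearby values from above by `g 0`, and one value near `g 0` bounds
all values further left from below. This also covers `g 0 = ∞`. -/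
theorem continuous_g (hd : 0 < d) (hφ : Monotone φ) : Continuous (g p φ) := by
  rw [continuous_iff_continuousAt]
  intro η
  rcases eq_or_ne η 0 with rfl | hη
  · refine tendsto_order.2 ⟨fun b hb => ?_, fun b hb => Eventually.of_forall fun η =>
      (g_anti hd hφ zero_le).trans_lt hb⟩
    rw [g, if_pos rfl] at hb
    have h1 := eventually_lt_of_lt_liminf hb
    obtain ⟨t, ht, ht0⟩ := (h1.and self_mem_nhdsWithin).exists
    filter_upwards [Iio_mem_nhds ht0] with s hs
    rw [← g_of_pos ht0] at ht
    exact ht.trans_le (g_anti hd hφ (mem_Iio.1 hs).le)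
  · have hηpos := pos_iff_ne_zero.2 hη
    refine (continuousAt_gPos (p := p) hd hφ hηpos).congr ?_
    filter_upwards [lt_mem_nhds hηpos] with t ht
    exact (g_of_pos ht).symm

theorem g_lt_top (hd : 0 < d) (hφ : Monotone φ) {η : ℝ≥0} (hη : 0 < η) : g p φ η < ∞ := by
  rw [g_of_pos hη]
  exact gPos_lt_top hd hφ hη

end

section

/-! ### The lower bound for the quantization error -/

variable {p : Seminorm ℝ (Fin d → ℝ)} {φ : ℝ≥0 → ℝ≥0}

/-- Grids of spacing proportional to `1 / c` that cover a ball with few points. -/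
theorem exists_covering_grid (hd : 0 < d) {ε : ℝ} (hε : 0 < ε) (R : ℝ) :
    ∃ s : ℝ, 0 < s ∧ ∀ c : ℝ, 0 < c → ∃ G : Finset (Fin d → ℝ),
      (∀ y ∈ Metric.ball (0 : Fin d → ℝ) R, ∃ z ∈ G, ‖y - z‖ ≤ s / c) ∧
      ∀ (x : Fin d → ℝ) (r : ℝ) [DecidablePred (· ∈ Metric.closedBall x r)], s / c ≤ 2 * r →
        ((G.filter (· ∈ Metric.closedBall x r)).card : ℝ) ≤ ε * (c * r) ^ d := by
  have hεd : 0 < ε ^ (1 / (d : ℝ)) := Real.rpow_pos_of_pos hε _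
  -- With this spacing, the counting bound `(4r/ℓ) ^ d` is exactly `ε (c r) ^ d`.
  refine ⟨4 / ε ^ (1 / (d : ℝ)), by positivity, fun c hc => ?_⟩
  set ℓ := 4 / ε ^ (1 / (d : ℝ)) / c with hℓdef
  have hℓ : 0 < ℓ := by positivity
  refine ⟨grid d ℓ (-⌈R / ℓ⌉) ⌈R / ℓ⌉, fun y hy => exists_mem_grid hℓ fun i => ?_,
    fun x r _ hr => ?_⟩
  · have h1 : ‖y i‖ < R := (norm_le_pi_norm y i).trans_lt (mem_ball_zero_iff.1 hy)
    have h2 : R ≤ ⌈R / ℓ⌉ * ℓ := (div_le_iff₀ hℓ).1 (Int.le_ceil _)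
    rw [Real.norm_eq_abs, abs_lt] at h1
    push_cast
    constructor <;> linarith
  · refine (card_grid_filter_closedBall_le hℓ hr _ _ x).trans_eq ?_
    have : 4 * r / ℓ = ε ^ (1 / (d : ℝ)) * (c * r) := by
      rw [hℓdef]
      field_simp
    rw [this, mul_pow, one_div, Real.rpow_inv_natCast_pow hε.le hd.ne']

open Classical in
/-- Only the points of a codebook near a cube matter for the cost on that cube, if every point
of the cube has a near neighbour in the codebook. -/
theorem mul_gPos_le_of_card_filter_le (hd : 0 < d) (hφ : Monotone φ) {A B : ℝ} (hA : 0 ≤ A)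
    (hpA : ∀ x, p x ≤ A * ‖x‖) (hB : 0 ≤ B) (hpB : ∀ x, ‖x‖ ≤ B * p x) {η c : ℝ≥0} (hη : 0 < η)
    {r ℓ δ : ℝ} (hr : 0 < r) (hδ : B * (A * ℓ) ≤ δ) {x : Fin d → ℝ} {D : Finset (Fin d → ℝ)}
    (hD : ∀ y ∈ Metric.closedBall x r, ∃ z ∈ D, ‖y - z‖ ≤ ℓ)
    (hcard : ((D.filter (· ∈ Metric.closedBall x (r + δ))).card : ℝ) ≤ η * (c * (2 * r)) ^ d) :
    ENNReal.ofReal ((2 * r) ^ d) * gPos p φ η ≤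
      ∫⁻ y in Metric.closedBall x r, (φ (c * codebookDist p D y) : ℝ≥0∞) := by
  -- A nearest code point is at `p`-distance at most `Aℓ`, hence at sup-distance at most `BAℓ ≤ δ`,
  -- so it lies in the enlarged cube.
  have hnear : ∀ y ∈ Metric.closedBall x r,
      ∃ z ∈ D.filter (· ∈ Metric.closedBall x (r + δ)), (codebookDist p D y : ℝ) = p (y - z) := by
    intro y hy
    obtain ⟨w, hw, hyw⟩ := hD y hy
    obtain ⟨z, hz, he⟩ := exists_codebookDist_eq (p := p) ⟨w, hw⟩ y
    refine ⟨z, Finset.mem_filter.2 ⟨hz, ?_⟩, he⟩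
    have h1 : p (y - z) ≤ A * ℓ := by
      rw [← he]
      exact (codebookDist_le hw).trans ((hpA _).trans (by gcongr))
    have h2 : dist z y ≤ δ := by
      rw [dist_comm, dist_eq_norm]
      exact (hpB _).trans ((mul_le_mul_of_nonneg_left h1 hB).trans hδ)
    rw [Metric.mem_closedBall] at hy ⊢
    linarith [dist_triangle z y x]
  obtain ⟨z₀, hz₀, -⟩ := hnear x (Metric.mem_closedBall_self hr.le)
  refine (mul_gPos_le_setLIntegral_closedBall hd hφ hη hr x ⟨z₀, hz₀⟩ hcard).trans ?_
  refine setLIntegral_mono' Metric.isClosed_closedBall.measurableSet fun y hy => ?_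
  obtain ⟨z, hz, he⟩ := hnear y hy
  refine ENNReal.coe_le_coe.2 (hφ (mul_le_mul_right (NNReal.coe_le_coe.1 ?_) _))
  rw [he]
  exact codebookDist_le hz

theorem empiricalMeasure_apply (N : ℕ+) {C : Finset (Fin d → ℝ)} (hC : C.card = N)
    {S : Set (Fin d → ℝ)} [DecidablePred (· ∈ S)] (hS : MeasurableSet S) :
    (empiricalMeasure N C hC : Measure (Fin d → ℝ)) S =
      ((N : ℕ) : ℝ≥0∞)⁻¹ * (C.filter (· ∈ S)).card := by
  have : (empiricalMeasure N C hC : Measure (Fin d → ℝ)) =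
    ((N : ℕ) : ℝ≥0∞)⁻¹ • ∑ y ∈ C, Measure.dirac y := rfl
  rw [this, Measure.smul_apply, Measure.finsetSum_apply, smul_eq_mul]
  congr 1
  simp_rw [Measure.dirac_apply' _ hS, indicator_apply, Pi.one_apply, Finset.sum_boole]

theorem acPart_le (μ : Measure (Fin d → ℝ)) : acPart μ ≤ μ := Measure.withDensity_rnDeriv_le μ volume

/-- The asymptotic cost of codebooks is bounded below on small cubes. -/
theorem eventually_mul_gPos_le (hd : 0 < d) (hφ : Monotone φ) (p : Seminorm ℝ (Fin d → ℝ))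
    (hp : ∀ x, p x = 0 → x = 0) {𝓕 : Filter ℕ+} (h𝓕 : 𝓕 ≤ atTop)
    {C G : ℕ+ → Finset (Fin d → ℝ)} (hC : ∀ N, (C N).card = N)
    {c : ℕ+ → ℝ≥0} {J : ℝ≥0} (hJ : 0 < J) (hcJ : ∀ N, J * c N ^ d = (N : ℕ))
    {ε s R : ℝ} (hε : 0 < ε)
    (hGcov : ∀ N, ∀ y ∈ Metric.ball (0 : Fin d → ℝ) R, ∃ z ∈ G N, ‖y - z‖ ≤ s / c N)
    (hGcard : ∀ N, ∀ (x : Fin d → ℝ) (r : ℝ) [DecidablePred (· ∈ Metric.closedBall x r)],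
      s / c N ≤ 2 * r →
        (((G N).filter (· ∈ Metric.closedBall x r)).card : ℝ) ≤ ε * (c N * r) ^ d)
    {x : Fin d → ℝ} {r δ : ℝ} (hr : 0 < r) (hδ : 0 < δ) (hδr : δ ≤ r)
    (hball : Metric.closedBall x r ⊆ Metric.ball 0 R) {τ : ℝ≥0}
    (hτ : limsup (fun N => (empiricalMeasure N (C N) (hC N) : Measure (Fin d → ℝ))
      (Metric.closedBall x (r + δ))) 𝓕 < ENNReal.ofReal ((2 * r) ^ d) * τ)
    {η : ℝ≥0} (hη : J * τ + ε ≤ η) :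
    ∀ᶠ N in 𝓕, ENNReal.ofReal ((2 * r) ^ d) * gPos p φ η ≤
      ∫⁻ y in Metric.closedBall x r, (φ (c N * codebookDist p (C N ∪ G N) y) : ℝ≥0∞) := by
  classical
  obtain ⟨A, hA, hpA⟩ := exists_seminorm_le_mul_norm p
  obtain ⟨B, hB, hpB⟩ := exists_norm_le_mul_seminorm p hp
  have hηpos : 0 < η := by
    have : (0 : ℝ) < η := lt_of_lt_of_le (by positivity) hη
    exact_mod_cast this
  have hcpos : ∀ N, 0 < c N := fun N => by
    refine pos_iff_ne_zero.2 fun h0 => ?_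
    have := hcJ N
    rw [h0, zero_pow hd.ne', mul_zero] at this
    exact N.ne_zero (by exact_mod_cast this.symm)
  have hc : Tendsto (fun N => (s / c N : ℝ)) atTop (𝓝 0) := by
    refine Tendsto.const_div_atTop (tendsto_atTop.2 fun b => ?_) s
    have h1 : Tendsto (fun N : ℕ+ => ((N : ℕ) : ℝ)) atTop atTop :=
      tendsto_natCast_atTop_atTop.comp tendsto_PNat_val_atTop_atTop
    filter_upwards [h1.eventually_gt_atTop (J * |b| ^ d)] with N hN
    by_contra! hlt
    have h2 : J * (c N : ℝ) ^ d = (N : ℕ) := by exact_mod_cast hcJ N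
    have h3 : (c N : ℝ) ^ d ≤ |b| ^ d := by
      gcongr
      exact hlt.le.trans (le_abs_self b)
    have h4 : J * (c N : ℝ) ^ d ≤ J * |b| ^ d := by gcongr
    linarith
  have hc1 : ∀ᶠ N in 𝓕, B * (A * (s / c N)) < δ := by
    refine h𝓕 (Tendsto.eventually_lt_const hδ ?_)
    simpa using (hc.const_mul A).const_mul B
  have hc2 : ∀ᶠ N in 𝓕, s / c N < r := h𝓕 (hc.eventually_lt_const hr)
  filter_upwards [hc1, hc2, eventually_lt_of_limsup_lt hτ] with N h1 h2 h3
  refine mul_gPos_le_of_card_filter_le hd hφ hA.le hpA hB.le hpB hηpos hr h1.le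
    (fun y hy => ?_) ?_
  · obtain ⟨z, hz, hyz⟩ := hGcov N y (hball hy)
    exact ⟨z, Finset.mem_union_right _ hz, hyz⟩
  · rw [empiricalMeasure_apply N (hC N) Metric.isClosed_closedBall.measurableSet] at h3
    have hN : ((N : ℕ) : ℝ) = J * c N ^ d := by exact_mod_cast (hcJ N).symm
    have hNpos : (0 : ℝ) < (N : ℕ) := by exact_mod_cast N.pos
    have h4 : (((C N).filter (· ∈ Metric.closedBall x (r + δ))).card : ℝ) ≤
        J * τ * (c N * (2 * r)) ^ d := by
      have h5 := ENNReal.toReal_mono (by finiteness) h3.le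
      rw [ENNReal.toReal_mul, ENNReal.toReal_mul, ENNReal.toReal_inv, ENNReal.toReal_natCast,
        ENNReal.toReal_natCast, ENNReal.toReal_ofReal (by positivity), ENNReal.coe_toReal,
        inv_mul_le_iff₀ hNpos, hN] at h5
      refine h5.trans_eq ?_
      rw [mul_pow]
      ring
    have h6 := hGcard N x (r + δ) (by linarith)
    rw [Finset.filter_union]
    calc _ ≤ (((C N).filter (· ∈ Metric.closedBall x (r + δ))).card : ℝ) +
          ((G N).filter (· ∈ Metric.closedBall x (r + δ))).card := by
          exact_mod_cast Finset.card_union_le _ _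
      _ ≤ J * τ * (c N * (2 * r)) ^ d + ε * (c N * (r + δ)) ^ d := add_le_add h4 h6
      -- The grid points are counted in the enlarged cube; `δ ≤ r` gives `r + δ ≤ 2r`.
      _ ≤ J * τ * (c N * (2 * r)) ^ d + ε * (c N * (2 * r)) ^ d := by
          gcongr
          linarith
      _ = (J * τ + ε) * (c N * (2 * r)) ^ d := by ring
      _ ≤ η * (c N * (2 * r)) ^ d := by gcongr

/-- Serves to freeze the density of `μ_c` at its value at a Lebesgue point, for a cost `F` bounded
by `K`. -/
theorem coe_mul_le_coe_mul_add {F K : ℝ≥0} (hF : F ≤ K) {a b : ℝ≥0∞} (ha : a ≠ ∞) :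
    (F : ℝ≥0∞) * a ≤ F * b + K * ‖b.toReal - a.toReal‖ₑ := by
  -- For `b = ∞` the real part is the default `0`, but then the right side is `∞` unless `F = 0`,
  -- when the left side vanishes.
  rcases eq_or_ne b ∞ with rfl | hb
  · rcases eq_or_ne F 0 with rfl | hF0
    · simp
    · simp [ENNReal.mul_top, hF0]
  · have h1 : a ≤ b + ‖b.toReal - a.toReal‖ₑ := by
      rw [Real.enorm_eq_ofReal_abs, ← ENNReal.toReal_le_toReal ha (by finiteness),
        ENNReal.toReal_add hb (by finiteness), ENNReal.toReal_ofReal (abs_nonneg _)]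
      linarith [neg_abs_le (b.toReal - a.toReal)]
    calc (F : ℝ≥0∞) * a ≤ F * (b + ‖b.toReal - a.toReal‖ₑ) := by gcongr
      _ = F * b + F * ‖b.toReal - a.toReal‖ₑ := mul_add _ _ _
      _ ≤ _ := by gcongr

theorem ae_tendsto_lintegral_closedBall_div {f : (Fin d → ℝ) → ℝ} (hf : Integrable f) :
    ∀ᵐ x, Tendsto (fun r => (∫⁻ y in Metric.closedBall x r, ‖f y - f x‖ₑ) /
      volume (Metric.closedBall x r)) (𝓝[>] 0) (𝓝 0) := by
  filter_upwards [(Besicovitch.vitaliFamily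
    (volume : Measure (Fin d → ℝ))).ae_tendsto_lintegral_enorm_sub_div_of_integrable hf] with x hx
  exact hx.comp (Besicovitch.tendsto_filterAt volume x)

/-- The lower bound on a ball, for a slightly increased point density. -/
theorem setLIntegral_ball_g_le (hd : 0 < d) (hφ : Monotone φ) (hp : ∀ x, p x = 0 → x = 0)
    (μ : Measure (Fin d → ℝ)) [IsFiniteMeasure μ] (𝒰 : Ultrafilter ℕ+)
    (h𝒰 : (𝒰 : Filter ℕ+) ≤ atTop) {C : ℕ+ → Finset (Fin d → ℝ)} (hC : ∀ N, (C N).card = N)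
    {J : ℝ≥0} (hJ : 0 < J)
    (hcost : ∀ᶠ N : ℕ+ in (𝒰 : Filter ℕ+),
      ∫⁻ x, (φ ((((N : ℕ) : ℝ≥0) / J) ^ (1 / (d : ℝ)) * codebookDist p (C N) x) : ℝ≥0∞) ∂μ ≤ 1)
    (ν : Measure (Fin d → ℝ)) [IsFiniteMeasure ν]
    (hν : ∀ K : Set (Fin d → ℝ), IsCompact K →
      limsup (fun N => (empiricalMeasure N (C N) (hC N) : Measure (Fin d → ℝ)) K) (𝒰 : Filter ℕ+)
        ≤ ν K)
    {ε : ℝ≥0} (hε : 0 < ε) (R : ℝ) :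
    ∫⁻ x in Metric.ball 0 R, g p φ (J * (ν.rnDeriv volume x).toNNReal + ε) ∂(acPart μ) ≤ 1 := by
  obtain ⟨A, hA, hpA⟩ := exists_seminorm_le_mul_norm p
  set c : ℕ+ → ℝ≥0 := fun N => (((N : ℕ) : ℝ≥0) / J) ^ (1 / (d : ℝ)) with hc
  have hcJ : ∀ N, J * c N ^ d = (N : ℕ) := fun N => by
    simp only [hc]
    rw [one_div, NNReal.rpow_inv_natCast_pow _ hd.ne', mul_div_cancel₀ _ hJ.ne']
  have hcpos : ∀ N, 0 < c N := fun N => NNReal.rpow_pos (by have := N.pos; positivity)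
  obtain ⟨s, hs, hG⟩ := exists_covering_grid hd (half_pos (NNReal.coe_pos.2 hε)) R
  choose G hGcov hGcard using fun N => hG (c N) (NNReal.coe_pos.2 (hcpos N))
  set F : ℕ+ → (Fin d → ℝ) → ℝ≥0 := fun N y => φ (c N * codebookDist p (C N ∪ G N) y) with hF
  have hFmeas : ∀ N, Measurable fun y => (F N y : ℝ≥0∞) := fun N => measurable_cost hφ p _ _
  set K : ℝ≥0 := φ (A * s).toNNReal with hK
  have hFK : ∀ N, ∀ y ∈ Metric.ball (0 : Fin d → ℝ) R, F N y ≤ K := fun N y hy => by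
    refine hφ (NNReal.coe_le_coe.1 ?_)
    obtain ⟨z, hz, hyz⟩ := hGcov N y hy
    have hcN : (0 : ℝ) < c N := hcpos N
    rw [Real.coe_toNNReal _ (by positivity), NNReal.coe_mul]
    calc (c N : ℝ) * codebookDist p (C N ∪ G N) y ≤ c N * (A * (s / c N)) := by
          gcongr
          exact (codebookDist_le (Finset.mem_union_right _ hz)).trans ((hpA _).trans (by gcongr))
      _ = A * s := by field_simp
  set h := μ.rnDeriv volume with hh
  have hhmeas : Measurable h := Measure.measurable_rnDeriv _ _
  set Q := Metric.ball (0 : Fin d → ℝ) R with hQ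
  -- Viewing the costs as measures lets their limit be differentiated, so bounds on single cubes
  -- become a pointwise bound.
  set ρN : ℕ+ → Measure (Fin d → ℝ) := fun N =>
    (volume.restrict Q).withDensity fun y => F N y * h y with hρN
  have hρN_mass : ∀ᶠ N in (𝒰 : Filter ℕ+), ρN N univ ≤ 1 := by
    filter_upwards [hcost] with N hN
    have hne : (C N).Nonempty := by
      rw [← Finset.card_pos, hC]
      exact N.pos
    calc ρN N univ = ∫⁻ y in Q, F N y * h y := by
          rw [hρN, withDensity_apply _ MeasurableSet.univ, Measure.restrict_univ]
      _ ≤ ∫⁻ y, F N y * h y := setLIntegral_le_lintegral _ _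
      _ = ∫⁻ y, F N y ∂(acPart μ) := by
          rw [acPart, lintegral_withDensity_eq_lintegral_mul _ hhmeas (hFmeas N)]
          simp [mul_comm, hh]
      _ ≤ ∫⁻ y, F N y ∂μ := lintegral_mono' (acPart_le μ) le_rfl
      _ ≤ _ := lintegral_mono fun y => ENNReal.coe_le_coe.2 <| hφ <|
          mul_le_mul_right (codebookDist_anti hne Finset.subset_union_left y) _
      _ ≤ 1 := hN
  obtain ⟨ρ, hρ1, hρ⟩ := exists_measure_limit_ultrafilter 𝒰 ρN 1 fun S _ => by
    filter_upwards [hρN_mass] with N hN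
    exact (measure_mono (subset_univ S)).trans (by simpa using hN)
  have : IsFiniteMeasure ρ := ⟨hρ1.trans_lt ENNReal.coe_lt_top⟩
  have hξ : Measurable fun x => g p φ (J * (ν.rnDeriv volume x).toNNReal + ε) :=
    (continuous_g hd hφ).measurable.comp
      (((Measure.measurable_rnDeriv _ _).ennreal_toNNReal.const_mul J).add_const ε)
  have hint : Integrable (fun y => (h y).toReal) := Measure.integrable_toReal_rnDeriv
  have key : ∀ᵐ x, x ∈ Q →
      h x * g p φ (J * (ν.rnDeriv volume x).toNNReal + ε) ≤ ρ.rnDeriv volume x := by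
    filter_upwards [Besicovitch.ae_tendsto_rnDeriv ν volume,
      Besicovitch.ae_tendsto_rnDeriv ρ volume, ae_tendsto_lintegral_closedBall_div hint,
      μ.rnDeriv_ne_top volume, ν.rnDeriv_ne_top volume] with x hxν hxρ hxh hx1 hx2 hxQ
    obtain ⟨ξ, hξx⟩ : ∃ ξ : ℝ≥0, (ξ : ℝ≥0∞) = ν.rnDeriv volume x :=
      ⟨_, ENNReal.coe_toNNReal hx2⟩
    rw [← hξx] at hxν ⊢
    rw [ENNReal.toNNReal_coe]
    set η := J * ξ + ε with hη
    have hηpos : 0 < η := by positivity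
    -- Half of `ε` pays for the grid: `J τ + ε/2 = η`. The gap between `τ'` and `τ` absorbs the
    -- factor `(1 + κ) ^ d` from enlarging the cube.
    set τ : ℝ≥0 := ξ + ε / (2 * J) with hτ
    set τ' : ℝ≥0 := ξ + ε / (4 * J) with hτ'
    have hττ' : τ' < τ := by
      rw [hτ, hτ']
      gcongr
      norm_num
    have hξτ' : ξ < τ' := lt_add_of_pos_right _ (by positivity)
    obtain ⟨κ, hκ0, hκ1, hκ⟩ : ∃ κ : ℝ, 0 < κ ∧ κ ≤ 1 ∧ (1 + κ) ^ d * τ' < τ := by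
      have h1 : ∀ᶠ κ : ℝ in 𝓝[>] (0 : ℝ), (1 + κ) ^ d * (τ' : ℝ) < τ := by
        refine eventually_nhdsWithin_of_eventually_nhds ?_
        have hcont : Continuous fun κ : ℝ => (1 + κ) ^ d * (τ' : ℝ) := by fun_prop
        refine (hcont.tendsto 0).eventually_lt_const ?_
        simpa using hττ'
      obtain ⟨κ, hκ, h0, h2⟩ := (h1.and (Ioc_mem_nhdsGT one_pos)).exists
      exact ⟨κ, h0, h2, hκ⟩
    have hvol : ∀ r : ℝ, 0 < r →
        volume (Metric.closedBall x r) = ENNReal.ofReal ((2 * r) ^ d) := fun r hr => by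
      rw [Real.volume_pi_closedBall _ hr.le, Fintype.card_fin]
    have hscale : Tendsto (fun r : ℝ => r + κ * r) (𝓝[>] 0) (𝓝[>] 0) := by
      refine tendsto_nhdsWithin_iff.2 ⟨?_, ?_⟩
      · refine tendsto_nhdsWithin_of_tendsto_nhds ?_
        have : Continuous fun r : ℝ => r + κ * r := by fun_prop
        simpa using this.tendsto 0
      · filter_upwards [self_mem_nhdsWithin] with r hr
        have hr' : 0 < r := hr
        exact mem_Ioi.2 (by positivity)
    have hQr : ∀ᶠ r in 𝓝[>] (0 : ℝ), Metric.closedBall x r ⊆ Q := by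
      obtain ⟨r₀, hr₀, hsub⟩ := Metric.nhds_basis_closedBall.mem_iff.1
        (Metric.isOpen_ball.mem_nhds hxQ)
      filter_upwards [Ioc_mem_nhdsGT hr₀] with r hr
      exact (Metric.closedBall_subset_closedBall hr.2).trans hsub
    have hνr := hscale.eventually
      (hxν.eventually_lt_const (ENNReal.coe_lt_coe.2 hξτ'))
    have hlim : Tendsto (fun r => ρ (Metric.closedBall x r) / volume (Metric.closedBall x r) +
        K * ((∫⁻ y in Metric.closedBall x r, ‖(h y).toReal - (h x).toReal‖ₑ) /
          volume (Metric.closedBall x r))) (𝓝[>] 0) (𝓝 (ρ.rnDeriv volume x + K * 0)) :=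
      hxρ.add (ENNReal.Tendsto.const_mul hxh (Or.inr ENNReal.coe_ne_top))
    rw [mul_zero, add_zero] at hlim
    refine ge_of_tendsto hlim ?_
    filter_upwards [hQr, hνr, self_mem_nhdsWithin] with r hrQ hrν hr
    have hr0 : 0 < r := hr
    have hv0 : volume (Metric.closedBall x r) ≠ 0 := by
      rw [hvol r hr0]
      exact (ENNReal.ofReal_pos.2 (by positivity)).ne'
    have hvt : volume (Metric.closedBall x r) ≠ ∞ := by
      rw [hvol r hr0]
      exact ENNReal.ofReal_ne_top
    have hlimsup : limsup (fun N => (empiricalMeasure N (C N) (hC N) : Measure (Fin d → ℝ))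
        (Metric.closedBall x (r + κ * r))) (𝒰 : Filter ℕ+) < ENNReal.ofReal ((2 * r) ^ d) * τ := by
      refine (hν _ (isCompact_closedBall _ _)).trans_lt ?_
      rw [hvol _ (by positivity), ENNReal.div_lt_iff (Or.inl ?_) (Or.inl ENNReal.ofReal_ne_top)]
        at hrν
      · refine hrν.trans_le ?_
        rw [← ENNReal.ofReal_coe_nnreal, ← ENNReal.ofReal_coe_nnreal,
          ← ENNReal.ofReal_mul (by positivity), ← ENNReal.ofReal_mul (by positivity)]
        refine ENNReal.ofReal_le_ofReal ?_
        have : 2 * (r + κ * r) = (2 * r) * (1 + κ) := by ring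
        rw [this, mul_pow]
        have := mul_le_mul_of_nonneg_left hκ.le (by positivity : 0 ≤ (2 * r) ^ d)
        linarith
      · exact (ENNReal.ofReal_pos.2 (by positivity)).ne'
    have hev := eventually_mul_gPos_le hd hφ p hp h𝒰 hC hJ hcJ
      (half_pos (NNReal.coe_pos.2 hε)) hGcov (fun N => hGcard N) hr0 (by positivity)
      (by nlinarith : κ * r ≤ r) hrQ hlimsup (η := η) (by
        rw [hη, hτ]
        push_cast
        have : (J : ℝ) ≠ 0 := by positivity
        apply le_of_eq
        field_simp
        ring)
    have hmain : h x * (volume (Metric.closedBall x r) * gPos p φ η) ≤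
        ρ (Metric.closedBall x r) +
          K * ∫⁻ y in Metric.closedBall x r, ‖(h y).toReal - (h x).toReal‖ₑ := by
      -- The oscillation of `h` does not depend on `N`, so it is subtracted before passing to the
      -- limit.
      refine tsub_le_iff_right.1 (le_trans ?_ (hρ _ (isCompact_closedBall x r)))
      refine le_limsup_of_le (by isBoundedDefault) fun b hb => ?_
      obtain ⟨N, hN1, hN2⟩ := (hb.and hev).exists
      refine le_trans (tsub_le_iff_right.2 ?_) hN1
      rw [hρN, withDensity_apply _ Metric.isClosed_closedBall.measurableSet,
        Measure.restrict_restrict Metric.isClosed_closedBall.measurableSet,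
        inter_eq_left.2 hrQ, ← lintegral_const_mul' _ _ ENNReal.coe_ne_top]
      have hFh : Measurable fun y => F N y * h y := (hFmeas N).mul hhmeas
      rw [← lintegral_add_left hFh, hvol r hr0]
      refine (mul_le_mul_right hN2 _).trans ?_
      rw [← lintegral_const_mul' _ _ hx1]
      refine setLIntegral_mono' Metric.isClosed_closedBall.measurableSet fun y hy => ?_
      rw [mul_comm]
      exact coe_mul_le_coe_mul_add (hFK N y (hrQ hy)) hx1
    rw [g_of_pos hηpos, ← mul_div_assoc, ENNReal.div_add_div_same, ENNReal.le_div_iff_mul_le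
      (Or.inl hv0) (Or.inl hvt)]
    refine le_trans (le_of_eq ?_) hmain
    ring
  rw [acPart, restrict_withDensity Metric.isOpen_ball.measurableSet,
    lintegral_withDensity_eq_lintegral_mul _ hhmeas hξ]
  calc ∫⁻ x in Q, (h * fun x => g p φ (J * (ν.rnDeriv volume x).toNNReal + ε)) x
      ≤ ∫⁻ x in Q, ρ.rnDeriv volume x :=
        setLIntegral_mono_ae' Metric.isOpen_ball.measurableSet key
    _ ≤ ∫⁻ x, ρ.rnDeriv volume x := setLIntegral_le_lintegral _ _
    _ ≤ ρ univ := Measure.lintegral_rnDeriv_le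
    _ ≤ 1 := by simpa using hρ1

end

section

/-! ### The point allocation problem -/

variable {p : Seminorm ℝ (Fin d → ℝ)} {φ : ℝ≥0 → ℝ≥0} {μ : Measure (Fin d → ℝ)}

theorem allocationValue_le {ξ : (Fin d → ℝ) → ℝ≥0} (hξ : Measurable ξ)
    (hfin : ∫⁻ x, (ξ x : ℝ≥0∞) ≠ ∞) (h : ∫⁻ x, g p φ (ξ x) ∂(acPart μ) ≤ 1) :
    allocationValue p φ μ ≤ ∫⁻ x, (ξ x : ℝ≥0∞) :=
  iInf₂_le_of_le ξ hξ (iInf₂_le_of_le hfin.lt_top h le_rfl)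

/-- The constraint of the point allocation problem is active at minimizers. -/
theorem one_le_lintegral_g (hd : 0 < d) (hφ : Monotone φ) [IsFiniteMeasure μ]
    (hI_pos : 0 < allocationValue p φ μ) (hI_fin : allocationValue p φ μ < ∞)
    {ξ : (Fin d → ℝ) → ℝ≥0} (hξ : Measurable ξ)
    (hξI : ∫⁻ x, (ξ x : ℝ≥0∞) ≤ allocationValue p φ μ) :
    1 ≤ ∫⁻ x, g p φ (ξ x) ∂(acPart μ) := by
  by_contra! hlt
  have hfin : ∫⁻ x, (ξ x : ℝ≥0∞) ≠ ∞ := (hξI.trans_lt hI_fin).ne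
  have hge : allocationValue p φ μ ≤ ∫⁻ x, (ξ x : ℝ≥0∞) := allocationValue_le hξ hfin hlt.le
  have : IsFiniteMeasure (acPart μ) := isFiniteMeasure_of_le μ (acPart_le μ)
  -- As `I > 0`, the function `ξ` cannot vanish almost everywhere; lowering it by a small `δ` where
  -- it is at least `a` keeps `g` bounded by `g (a / 2)` there.
  obtain ⟨a, ha, haB⟩ : ∃ a : ℝ≥0, 0 < a ∧ 0 < volume {x | a ≤ ξ x} := by
    by_contra! hcon
    have h0 : ∀ᵐ x, ∀ n : ℕ, ¬ (1 / (n + 1 : ℝ≥0) ≤ ξ x) := ae_all_iff.2 fun n => by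
      have := hcon (1 / (n + 1 : ℝ≥0)) (by positivity)
      simpa [ae_iff] using this
    have h1 : ∀ᵐ x, (ξ x : ℝ≥0∞) = 0 := by
      filter_upwards [h0] with x hx
      by_contra hne
      have hpos : 0 < ξ x := pos_iff_ne_zero.2 fun h => hne (by simp [h])
      obtain ⟨n, hn⟩ := exists_nat_one_div_lt (NNReal.coe_pos.2 hpos)
      exact hx n (NNReal.coe_le_coe.1 (by push_cast; exact hn.le))
    rw [lintegral_congr_ae h1, lintegral_zero] at hge
    exact (hI_pos.trans_le hge).ne rfl
  set B := {x | a ≤ ξ x} with hB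
  have hBm : MeasurableSet B := measurableSet_le measurable_const hξ
  set F : ℝ≥0 → (Fin d → ℝ) → ℝ≥0 := fun δ x => ξ x - B.indicator (fun _ => δ) x with hF
  have hFm : ∀ δ, Measurable (F δ) := fun δ => hξ.sub (measurable_const.indicator hBm)
  have hlim : Tendsto (fun δ => ∫⁻ x, g p φ (F δ x) ∂(acPart μ)) (𝓝[>] 0)
      (𝓝 (∫⁻ x, g p φ (ξ x) ∂(acPart μ))) := by
    refine tendsto_lintegral_filter_of_dominated_convergence
      (fun x => g p φ (ξ x) + g p φ (a / 2))
      (Eventually.of_forall fun δ => (continuous_g hd hφ).measurable.comp (hFm δ)) ?_ ?_ ?_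
    · filter_upwards [Ioo_mem_nhdsGT (half_pos ha)] with δ hδ
      refine Eventually.of_forall fun x => ?_
      by_cases hx : x ∈ B
      · refine le_add_left (g_anti hd hφ ?_)
        simp only [hF, indicator_of_mem hx]
        refine le_tsub_of_add_le_right ?_
        calc a / 2 + δ ≤ a / 2 + a / 2 := by gcongr; exact hδ.2.le
          _ = a := add_halves a
          _ ≤ ξ x := hx
      · simp [hF, hx]
    · rw [lintegral_add_right _ measurable_const, lintegral_const]
      exact ENNReal.add_ne_top.2 ⟨hlt.ne_top,
        ENNReal.mul_ne_top (g_lt_top hd hφ (half_pos ha)).ne (measure_ne_top _ _)⟩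
    · refine Eventually.of_forall fun x => ?_
      refine ((continuous_g hd hφ).tendsto _).comp ?_
      refine tendsto_nhdsWithin_of_tendsto_nhds ?_
      by_cases hx : x ∈ B
      · simp only [hF, indicator_of_mem hx]
        have : Continuous fun δ : ℝ≥0 => ξ x - δ := by fun_prop
        simpa using this.tendsto 0
      · simp [hF, hx]
  obtain ⟨δ, hδ1, hδ⟩ := ((hlim.eventually_lt_const hlt).and (Ioo_mem_nhdsGT ha)).exists
  have hFξ : ∀ x, F δ x ≤ ξ x := fun x => tsub_le_self
  have hFfin : ∫⁻ x, (F δ x : ℝ≥0∞) ≠ ∞ :=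
    ne_top_of_le_ne_top hfin (lintegral_mono fun x => ENNReal.coe_le_coe.2 (hFξ x))
  -- The lowered function is still admissible, so minimality forces it to equal `ξ` almost
  -- everywhere, which fails on `B`.
  have h1 : ∫⁻ x, (ξ x : ℝ≥0∞) ≤ ∫⁻ x, (F δ x : ℝ≥0∞) :=
    hξI.trans (allocationValue_le (hFm δ) hFfin hδ1.le)
  have h2 := ae_eq_of_ae_le_of_lintegral_le
    (Eventually.of_forall fun x => ENNReal.coe_le_coe.2 (hFξ x)) hFfin
    hξ.coe_nnreal_ennreal.aemeasurable h1
  refine haB.ne' (measure_mono_null (fun x hx => ?_) (ae_iff.1 h2))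
  intro heq
  have h3 : F δ x = ξ x := ENNReal.coe_injective heq
  simp only [hF, indicator_of_mem hx] at h3
  exact (tsub_lt_self (ha.trans_le hx) hδ.1).ne h3

/-- The optimality of the codebooks in terms of expectations. -/
theorem eventually_lintegral_le_one (hφ : Monotone φ) (hd : 0 < d) {Ω : Type*}
    [MeasurableSpace Ω] {P : Measure Ω} {X : Ω → Fin d → ℝ} (hX : Measurable X)
    {C : ℕ+ → Finset (Fin d → ℝ)} {I : ℝ≥0∞}
    (hopt : limsup (fun N : ℕ+ => ((N : ℕ) : ℝ≥0∞) ^ (1 / (d : ℝ)) *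
        orliczNorm φ P (fun ω => codebookDist p (C N) (X ω))) atTop ≤ I ^ (1 / (d : ℝ)))
    {J : ℝ≥0} (hJ : I < J) :
    ∀ᶠ N : ℕ+ in atTop,
      ∫⁻ x, (φ ((((N : ℕ) : ℝ≥0) / J) ^ (1 / (d : ℝ)) * codebookDist p (C N) x) : ℝ≥0∞)
        ∂(P.map X) ≤ 1 := by
  have hd' : 0 < 1 / (d : ℝ) := by positivity
  filter_upwards [eventually_lt_of_limsup_lt (hopt.trans_lt (ENNReal.rpow_lt_rpow hJ hd'))]
    with N hN
  have hN0 : 0 < ((N : ℕ) : ℝ≥0) ^ (1 / (d : ℝ)) :=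
    NNReal.rpow_pos (by exact_mod_cast N.pos)
  have hcast : ((N : ℕ) : ℝ≥0∞) ^ (1 / (d : ℝ)) = (((N : ℕ) : ℝ≥0) ^ (1 / (d : ℝ)) : ℝ≥0) := by
    rw [ENNReal.coe_rpow_of_nonneg _ hd'.le, ENNReal.coe_natCast]
  rw [hcast, ← ENNReal.coe_rpow_of_nonneg _ hd'.le, mul_comm, ← ENNReal.lt_div_iff_mul_lt
    (Or.inl (by exact_mod_cast hN0.ne')) (Or.inl ENNReal.coe_ne_top),
    ← ENNReal.coe_div hN0.ne', orliczNorm] at hN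
  simp only [iInf_lt_iff] at hN
  obtain ⟨t, ht, ht1, htlt⟩ := hN
  have htlt' : t < J ^ (1 / (d : ℝ)) / ((N : ℕ) : ℝ≥0) ^ (1 / (d : ℝ)) := by exact_mod_cast htlt
  rw [lintegral_map (measurable_cost hφ p _ _) hX]
  refine (lintegral_mono fun ω => ENNReal.coe_le_coe.2 (hφ ?_)).trans ht1
  rw [NNReal.div_rpow, div_eq_mul_inv (codebookDist p (C N) (X ω)), mul_comm]
  refine mul_le_mul_right ?_ _
  rw [← inv_div]
  exact inv_anti₀ ht htlt'.le

/-- A limit of empirical measures of asymptotically optimal codebooks has an admissible density. -/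
theorem lintegral_g_rnDeriv_le_one (hd : 0 < d) (hφ : Monotone φ) (hp : ∀ x, p x = 0 → x = 0)
    [IsFiniteMeasure μ] (𝒰 : Ultrafilter ℕ+) (h𝒰 : (𝒰 : Filter ℕ+) ≤ atTop)
    {C : ℕ+ → Finset (Fin d → ℝ)} (hC : ∀ N, (C N).card = N) {I : ℝ≥0}
    (hcost : ∀ J : ℝ≥0, I < J → ∀ᶠ N : ℕ+ in atTop,
      ∫⁻ x, (φ ((((N : ℕ) : ℝ≥0) / J) ^ (1 / (d : ℝ)) * codebookDist p (C N) x) : ℝ≥0∞) ∂μ ≤ 1)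
    (ν : Measure (Fin d → ℝ)) [IsFiniteMeasure ν]
    (hν : ∀ K : Set (Fin d → ℝ), IsCompact K →
      limsup (fun N => (empiricalMeasure N (C N) (hC N) : Measure (Fin d → ℝ)) K) (𝒰 : Filter ℕ+)
        ≤ ν K) :
    ∫⁻ x, g p φ (I * (ν.rnDeriv volume x).toNNReal) ∂(acPart μ) ≤ 1 := by
  set ε : ℕ → ℝ≥0 := fun n => 1 / (n + 1) with hε
  have hεpos : ∀ n, 0 < ε n := fun n => by positivity
  have hεlim : Tendsto ε atTop (𝓝 0) := tendsto_one_div_add_atTop_nhds_zero_nat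
  set ξ : (Fin d → ℝ) → ℝ≥0 := fun x => (ν.rnDeriv volume x).toNNReal with hξ
  have hξm : Measurable ξ := (Measure.measurable_rnDeriv _ _).ennreal_toNNReal
  -- Here `J = I + ε n` tends to `I` while the balls exhaust the space; only an upper bound is
  -- wanted, so Fatou suffices.
  set f : ℕ → (Fin d → ℝ) → ℝ≥0∞ := fun n =>
    (Metric.ball 0 n).indicator fun x => g p φ ((I + ε n) * ξ x + ε n) with hf
  have hfm : ∀ n, Measurable (f n) := fun n =>
    ((continuous_g hd hφ).measurable.comp ((hξm.const_mul _).add_const _)).indicator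
      Metric.isOpen_ball.measurableSet
  have hfle : ∀ n, ∫⁻ x, f n x ∂(acPart μ) ≤ 1 := fun n => by
    rw [hf, lintegral_indicator Metric.isOpen_ball.measurableSet]
    have hJ : I < I + ε n := lt_add_of_pos_right _ (hεpos n)
    exact setLIntegral_ball_g_le hd hφ hp μ 𝒰 h𝒰 hC (add_pos_of_nonneg_of_pos zero_le (hεpos n))
      (h𝒰 (hcost _ hJ)) ν hν (hεpos n) n
  have hflim : ∀ x, Tendsto (fun n => f n x) atTop (𝓝 (g p φ (I * ξ x))) := fun x => by
    have h1 : Tendsto (fun n => g p φ ((I + ε n) * ξ x + ε n)) atTop (𝓝 (g p φ (I * ξ x))) := by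
      refine ((continuous_g hd hφ).tendsto _).comp ?_
      simpa using ((hεlim.const_add I).mul_const (ξ x)).add hεlim
    refine h1.congr' ?_
    filter_upwards [tendsto_natCast_atTop_atTop.eventually_gt_atTop ‖x‖] with n hn
    have hx : x ∈ Metric.ball (0 : Fin d → ℝ) n := mem_ball_zero_iff.2 hn
    simp only [hf, indicator_of_mem hx]
  calc ∫⁻ x, g p φ (I * ξ x) ∂(acPart μ) = ∫⁻ x, liminf (fun n => f n x) atTop ∂(acPart μ) :=
        lintegral_congr fun x => (hflim x).liminf_eq.symm
    _ ≤ liminf (fun n => ∫⁻ x, f n x ∂(acPart μ)) atTop := lintegral_liminf_le hfm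
    _ ≤ 1 := (liminf_le_liminf (Eventually.of_forall hfle)).trans_eq (liminf_const _)

/-- Minimality of `I` applied to `I ξ` gives `I ≤ I ∫ ξ`. This one inequality excludes escaping
mass, singular parts and distinct solutions that agree `μ_c`-almost everywhere. -/
theorem one_le_lintegral_of_lintegral_g_le (hI_pos : 0 < allocationValue p φ μ)
    (hI_fin : allocationValue p φ μ < ∞) {ξ : (Fin d → ℝ) → ℝ≥0} (hξ : Measurable ξ)
    (h : ∫⁻ x, g p φ ((allocationValue p φ μ).toNNReal * ξ x) ∂(acPart μ) ≤ 1) :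
    1 ≤ ∫⁻ x, (ξ x : ℝ≥0∞) := by
  by_contra! hlt
  have h1 : ∫⁻ x, (((allocationValue p φ μ).toNNReal * ξ x : ℝ≥0) : ℝ≥0∞) =
      allocationValue p φ μ * ∫⁻ x, (ξ x : ℝ≥0∞) := by
    rw [← lintegral_const_mul' _ _ hI_fin.ne]
    simp [ENNReal.coe_toNNReal hI_fin.ne]
  have h2 := allocationValue_le (hξ.const_mul _)
    (by rw [h1]; exact ENNReal.mul_ne_top hI_fin.ne hlt.ne_top) h
  rw [h1] at h2
  have h3 := ENNReal.mul_lt_mul_right hI_pos.ne' hI_fin.ne hlt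
  rw [mul_one] at h3
  exact (h2.trans_lt h3).false

/-! ### Strict convexity -/

theorem two_mul_lt_add_of_strictConvexOn {f : ℝ≥0 → ℝ≥0∞} (hf : StrictConvexOn ℝ≥0 (Ioi 0) f)
    {x y : ℝ≥0} (hx : 0 < x) (hy : 0 < y) (hxy : x ≠ y) : 2 * f ((x + y) / 2) < f x + f y := by
  have hhalf : (0 : ℝ≥0) < 1 / 2 := by positivity
  have h := hf.2 (mem_Ioi.2 hx) (mem_Ioi.2 hy) hxy hhalf hhalf (add_halves 1)
  have h1 : (1 / 2 : ℝ≥0) • x + (1 / 2 : ℝ≥0) • y = (x + y) / 2 := by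
    rw [smul_eq_mul, smul_eq_mul]; ring
  rw [h1, ← smul_add, ENNReal.smul_def, smul_eq_mul] at h
  have h2 := ENNReal.mul_lt_mul_right two_ne_zero (by simp) h
  rwa [← mul_assoc, one_div, ENNReal.coe_inv two_ne_zero, ENNReal.coe_ofNat,
    ENNReal.mul_inv_cancel two_ne_zero (by simp), one_mul] at h2

/-- Strict convexity on `(0, ∞)` extends to `0` for continuous decreasing functions. -/
theorem two_mul_lt_add_of_zero {f : ℝ≥0 → ℝ≥0∞} (hf : StrictConvexOn ℝ≥0 (Ioi 0) f)
    (hanti : Antitone f) (hcont : Continuous f) (hfin : ∀ x, 0 < x → f x < ∞) {y : ℝ≥0}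
    (hy : 0 < y) : 2 * f (y / 2) < f 0 + f y := by
  rcases eq_or_ne (f 0) ∞ with h0 | h0
  · rw [h0, top_add]
    exact ENNReal.mul_lt_top (by simp) (hfin _ (by positivity))
  -- A limit at `0` gives only a weak inequality. Strictness comes from the interior points `y/4,
  -- y/2, 3y/4, y`: adding `e1`, `e2` and twice `e3` cancels the quarter points.
  have e1 : 2 * f (y / 4) ≤ f 0 + f (y / 2) := by
    have hlim : Tendsto (fun t => 2 * f ((t + y / 2) / 2)) (𝓝[>] 0) (𝓝 (2 * f (y / 4))) := by
      have hc : Continuous fun t : ℝ≥0 => 2 * f ((t + y / 2) / 2) :=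
        ENNReal.continuous_const_mul (by simp) |>.comp (hcont.comp (by fun_prop))
      have := tendsto_nhdsWithin_of_tendsto_nhds (s := Ioi 0) (hc.tendsto 0)
      rwa [zero_add, div_div, show (2 : ℝ≥0) * 2 = 4 by norm_num] at this
    refine le_of_tendsto hlim ?_
    filter_upwards [Ioo_mem_nhdsGT (by positivity : 0 < y / 2)] with t ht
    exact (two_mul_lt_add_of_strictConvexOn hf ht.1 (by positivity) ht.2.ne).le.trans
      (by gcongr; exact hanti zero_le)
  have e2 := two_mul_lt_add_of_strictConvexOn hf (x := y / 2) (y := y) (by positivity) hy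
    (NNReal.half_lt_self hy.ne').ne
  have e3 := two_mul_lt_add_of_strictConvexOn hf (x := y / 4) (y := (y / 2 + y) / 2)
    (by positivity) (by positivity) (by
      intro h
      have := congrArg NNReal.toReal h
      push_cast at this
      have : (0 : ℝ) < y := hy
      linarith)
  have hmid : (y / 4 + (y / 2 + y) / 2) / 2 = y / 2 := by
    apply NNReal.eq; push_cast; ring
  rw [hmid] at e3
  lift f 0 to ℝ≥0 using h0 with f0
  lift f (y / 4) to ℝ≥0 using (hfin _ (by positivity)).ne with f4
  lift f (y / 2) to ℝ≥0 using (hfin _ (by positivity)).ne with f2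
  lift f ((y / 2 + y) / 2) to ℝ≥0 using (hfin _ (by positivity)).ne with f3
  lift f y to ℝ≥0 using (hfin _ hy).ne with f1
  norm_cast at *
  rw [← NNReal.coe_lt_coe] at *
  rw [← NNReal.coe_le_coe] at e1
  push_cast at *
  linarith

theorem two_mul_lt_add {f : ℝ≥0 → ℝ≥0∞} (hf : StrictConvexOn ℝ≥0 (Ioi 0) f)
    (hanti : Antitone f) (hcont : Continuous f) (hfin : ∀ x, 0 < x → f x < ∞) {x y : ℝ≥0}
    (hxy : x ≠ y) : 2 * f ((x + y) / 2) < f x + f y := by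
  rcases eq_or_ne x 0 with rfl | hx
  · rw [zero_add]
    exact two_mul_lt_add_of_zero hf hanti hcont hfin (pos_iff_ne_zero.2 hxy.symm)
  rcases eq_or_ne y 0 with rfl | hy
  · rw [add_zero, add_comm]
    exact two_mul_lt_add_of_zero hf hanti hcont hfin (pos_iff_ne_zero.2 hx)
  exact two_mul_lt_add_of_strictConvexOn hf (pos_iff_ne_zero.2 hx) (pos_iff_ne_zero.2 hy) hxy

/-- Solutions of the point allocation problem are unique if `g` is strictly convex. -/
theorem eq_of_mem_minimizerMeasures (hd : 0 < d) (hφ : Monotone φ) [IsFiniteMeasure μ]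
    (hI_pos : 0 < allocationValue p φ μ) (hI_fin : allocationValue p φ μ < ∞)
    (hconv : StrictConvexOn ℝ≥0 (Ioi 0) (g p φ)) {ν₁ ν₂ : ProbabilityMeasure (Fin d → ℝ)}
    (h₁ : ν₁ ∈ minimizerMeasures p φ μ) (h₂ : ν₂ ∈ minimizerMeasures p φ μ) : ν₁ = ν₂ := by
  obtain ⟨ξ₁, hm₁, hν₁, hg₁, hi₁⟩ := h₁
  obtain ⟨ξ₂, hm₂, hν₂, hg₂, hi₂⟩ := h₂
  set I := (allocationValue p φ μ).toNNReal with hI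
  have hIpos : 0 < I := ENNReal.toNNReal_pos hI_pos.ne' hI_fin.ne
  have hIcoe : (I : ℝ≥0∞) = allocationValue p φ μ := ENNReal.coe_toNNReal hI_fin.ne
  have hgm : ∀ {ξ : (Fin d → ℝ) → ℝ≥0}, Measurable ξ → Measurable fun x => g p φ (I * ξ x) :=
    fun hξ => (continuous_g hd hφ).measurable.comp (hξ.const_mul I)
  have hae : ∀ᵐ x ∂(acPart μ), ξ₁ x = ξ₂ x := by
    by_contra hne
    set m : (Fin d → ℝ) → ℝ≥0 := fun x => (ξ₁ x + ξ₂ x) / 2 with hm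
    have hmm : Measurable m := (hm₁.add hm₂).div_const 2
    have hmI : ∀ x, I * m x = (I * ξ₁ x + I * ξ₂ x) / 2 := fun x => by rw [hm]; ring
    have hlt : ∀ x, ξ₁ x ≠ ξ₂ x → 2 * g p φ (I * m x) < g p φ (I * ξ₁ x) + g p φ (I * ξ₂ x) :=
      fun x hx => by
        rw [hmI]
        exact two_mul_lt_add hconv (g_anti hd hφ) (continuous_g hd hφ)
          (fun x hx => g_lt_top hd hφ hx) fun h => hx (mul_left_cancel₀ hIpos.ne' h)
    have hle : ∀ x, 2 * g p φ (I * m x) ≤ g p φ (I * ξ₁ x) + g p φ (I * ξ₂ x) := fun x => by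
      by_cases hx : ξ₁ x = ξ₂ x
      · rw [hmI, ← hx, add_self_div_two, two_mul]
      · exact (hlt x hx).le
    have hsum : ∫⁻ x, (g p φ (I * ξ₁ x) + g p φ (I * ξ₂ x)) ∂(acPart μ) = 2 := by
      rw [lintegral_add_left (hgm hm₁), hg₁, hg₂, one_add_one_eq_two]
    -- The midpoint again has total mass `I`, so the constraint is active for it as well.
    have hone : 1 ≤ ∫⁻ x, g p φ (I * m x) ∂(acPart μ) := by
      refine one_le_lintegral_g hd hφ hI_pos hI_fin (hmm.const_mul I) (le_of_eq ?_)
      have : ∀ x, ((I * m x : ℝ≥0) : ℝ≥0∞) = (I / 2 : ℝ≥0) * (ξ₁ x + ξ₂ x) := fun x => by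
        rw [← ENNReal.coe_add, ← ENNReal.coe_mul, hm]
        congr 1
        ring
      simp_rw [this]
      rw [lintegral_const_mul' _ _ ENNReal.coe_ne_top,
        lintegral_add_left hm₁.coe_nnreal_ennreal, hi₁, hi₂, ← hIcoe, one_add_one_eq_two]
      exact_mod_cast congrArg ((↑) : ℝ≥0 → ℝ≥0∞) (div_mul_cancel₀ I two_ne_zero)
    have htwo : (2 : ℝ≥0∞) ≤ ∫⁻ x, 2 * g p φ (I * m x) ∂(acPart μ) := by
      rw [lintegral_const_mul' _ _ (by simp)]
      exact le_mul_of_one_le_right zero_le hone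
    have heq := ae_eq_of_ae_le_of_lintegral_le (Eventually.of_forall hle)
      (ne_top_of_le_ne_top (by rw [hsum]; simp) (lintegral_mono hle))
      ((hgm hm₁).add (hgm hm₂)).aemeasurable (by rw [hsum]; exact htwo)
    refine hne ?_
    filter_upwards [heq] with x hx
    by_contra hx'
    exact (hlt x hx').ne hx
  -- The constraint says nothing where `μ_c` has no mass. There the minimum is used: it still
  -- satisfies the constraint, so its integral is at least `1` and it equals both densities.
  set m : (Fin d → ℝ) → ℝ≥0 := fun x => min (ξ₁ x) (ξ₂ x) with hm
  have hmm : Measurable m := hm₁.min hm₂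
  have hm1 : 1 ≤ ∫⁻ x, (m x : ℝ≥0∞) := by
    refine one_le_lintegral_of_lintegral_g_le hI_pos hI_fin hmm (le_of_eq ?_)
    rw [← hg₁]
    refine lintegral_congr_ae ?_
    filter_upwards [hae] with x hx
    simp [hm, hx, hI]
  have hmle₁ : ∀ x, (m x : ℝ≥0∞) ≤ ξ₁ x := fun x => ENNReal.coe_le_coe.2 (min_le_left _ _)
  have hmle₂ : ∀ x, (m x : ℝ≥0∞) ≤ ξ₂ x := fun x => ENNReal.coe_le_coe.2 (min_le_right _ _)
  have hmfin : ∫⁻ x, (m x : ℝ≥0∞) ≠ ∞ :=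
    ne_top_of_le_ne_top (by rw [hi₁]; simp) (lintegral_mono hmle₁)
  have heq₁ := ae_eq_of_ae_le_of_lintegral_le (Eventually.of_forall hmle₁) hmfin
    hm₁.coe_nnreal_ennreal.aemeasurable (hi₁.trans_le hm1)
  have heq₂ := ae_eq_of_ae_le_of_lintegral_le (Eventually.of_forall hmle₂) hmfin
    hm₂.coe_nnreal_ennreal.aemeasurable (hi₂.trans_le hm1)
  refine Subtype.ext ?_
  change (ν₁ : Measure (Fin d → ℝ)) = ν₂
  rw [hν₁, hν₂]
  exact withDensity_congr_ae (heq₁.symm.trans heq₂)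

/-! ### Limits of the empirical measures -/

/-- The absolutely continuous part of `ν` already has mass `1` by minimality, which leaves no room
for a singular part. -/
theorem mem_minimizerMeasures (hd : 0 < d) (hφ : Monotone φ) [IsFiniteMeasure μ]
    (hI_pos : 0 < allocationValue p φ μ) (hI_fin : allocationValue p φ μ < ∞)
    (ν : ProbabilityMeasure (Fin d → ℝ))
    (h : ∫⁻ x, g p φ ((allocationValue p φ μ).toNNReal *
      ((ν : Measure (Fin d → ℝ)).rnDeriv volume x).toNNReal) ∂(acPart μ) ≤ 1) :
    ν ∈ minimizerMeasures p φ μ := by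
  set ξ : (Fin d → ℝ) → ℝ≥0 :=
    fun x => ((ν : Measure (Fin d → ℝ)).rnDeriv volume x).toNNReal with hξ
  have hξm : Measurable ξ := (Measure.measurable_rnDeriv _ _).ennreal_toNNReal
  have hξae : (fun x => (ξ x : ℝ≥0∞)) =ᵐ[volume] (ν : Measure (Fin d → ℝ)).rnDeriv volume := by
    filter_upwards [(ν : Measure (Fin d → ℝ)).rnDeriv_ne_top volume] with x hx
    exact ENNReal.coe_toNNReal hx
  have h1 : ∫⁻ x, (ξ x : ℝ≥0∞) = 1 := by
    refine le_antisymm ?_ (one_le_lintegral_of_lintegral_g_le hI_pos hI_fin hξm h)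
    rw [lintegral_congr_ae hξae]
    exact Measure.lintegral_rnDeriv_le.trans_eq measure_univ
  refine ⟨ξ, hξm, ?_, le_antisymm h ?_, h1⟩
  · have hle : volume.withDensity (fun x => (ξ x : ℝ≥0∞)) ≤ (ν : Measure (Fin d → ℝ)) := by
      rw [withDensity_congr_ae hξae]
      exact Measure.withDensity_rnDeriv_le _ _
    have : IsFiniteMeasure (volume.withDensity fun x => (ξ x : ℝ≥0∞)) :=
      isFiniteMeasure_of_le _ hle
    refine (Measure.eq_of_le_of_measure_univ_eq hle ?_).symm
    rw [withDensity_apply _ MeasurableSet.univ, Measure.restrict_univ, h1, measure_univ]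
  · refine one_le_lintegral_g hd hφ hI_pos hI_fin (hξm.const_mul _) (le_of_eq ?_)
    simp_rw [ENNReal.coe_mul]
    rw [lintegral_const_mul' _ _ ENNReal.coe_ne_top, h1, mul_one, ENNReal.coe_toNNReal hI_fin.ne]

/-- Empirical measures that are not tight lose mass along a suitable ultrafilter. -/
theorem exists_ultrafilter_of_not_isTightMeasureSet {C : ℕ+ → Finset (Fin d → ℝ)}
    (hC : ∀ N, (C N).card = N)
    (h : ¬ IsTightMeasureSet (range fun N : ℕ+ =>
      (empiricalMeasure N (C N) (hC N) : Measure (Fin d → ℝ)))) :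
    ∃ 𝒰 : Ultrafilter ℕ+, (𝒰 : Filter ℕ+) ≤ atTop ∧ ∃ a : ℝ≥0, a < 1 ∧
      ∀ K : Set (Fin d → ℝ), IsCompact K → ∀ᶠ N in (𝒰 : Filter ℕ+),
        (empiricalMeasure N (C N) (hC N) : Measure (Fin d → ℝ)) K ≤ a := by
  classical
  rw [isTightMeasureSet_iff_exists_isCompact_measure_compl_le] at h
  push Not at h
  obtain ⟨ε, hε, h⟩ := h
  have h' : ∀ n : ℕ, ∃ N : ℕ+, ε < (empiricalMeasure N (C N) (hC N) : Measure (Fin d → ℝ))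
      (Metric.closedBall 0 n)ᶜ := fun n => by
    obtain ⟨_, ⟨N, rfl⟩, hN⟩ := h _ (isCompact_closedBall (0 : Fin d → ℝ) n)
    exact ⟨N, hN⟩
  choose N hN using h'
  -- A single codebook is bounded, so no index can lose mass to infinity for arbitrarily large
  -- balls; hence `N n → ∞`.
  have hne : ∀ M : ℕ+, ∀ᶠ n in atTop, N n ≠ M := fun M => by
    obtain ⟨R, hR⟩ := (C M).finite_toSet.isBounded.subset_closedBall 0
    filter_upwards [tendsto_natCast_atTop_atTop.eventually_ge_atTop R] with n hn heq
    have h1 := hN n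
    have h2 : (C M).filter (· ∈ (Metric.closedBall (0 : Fin d → ℝ) n)ᶜ) = ∅ :=
      Finset.filter_false_of_mem fun y hy => not_not.2
        (Metric.closedBall_subset_closedBall hn (hR hy))
    rw [heq, empiricalMeasure_apply M (hC M) Metric.isClosed_closedBall.measurableSet.compl,
      h2] at h1
    simp at h1
  have hNtop : Tendsto N atTop atTop := by
    refine tendsto_atTop.2 fun M => ?_
    filter_upwards [(Finset.eventually_all (Finset.Iio M)).2 fun M' _ => hne M'] with n hn
    by_contra! hlt
    exact hn (N n) (Finset.mem_Iio.2 hlt) rfl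
  refine ⟨(hyperfilter ℕ).map N, hNtop.mono_left Nat.hyperfilter_le_atTop, (1 - ε).toNNReal,
    ?_, fun K hK => ?_⟩
  · rw [← ENNReal.coe_lt_coe, ENNReal.coe_toNNReal (by finiteness), ENNReal.coe_one]
    exact ENNReal.sub_lt_self ENNReal.one_ne_top one_ne_zero hε.ne'
  · obtain ⟨R, hR⟩ := hK.isBounded.subset_closedBall 0
    rw [Ultrafilter.coe_map, eventually_map]
    refine Nat.hyperfilter_le_atTop ?_
    filter_upwards [tendsto_natCast_atTop_atTop.eventually_ge_atTop R] with n hn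
    rw [ENNReal.coe_toNNReal (by finiteness)]
    refine (measure_mono (hR.trans (Metric.closedBall_subset_closedBall hn))).trans ?_
    have h1 := hN n
    rw [prob_compl_eq_one_sub Metric.isClosed_closedBall.measurableSet] at h1
    exact ENNReal.le_sub_of_add_le_right h1.ne_top (add_comm ε _ ▸ (lt_tsub_iff_right.1 h1).le)

end

end OrliczQuantization

end

theorem theorem1p3 (d : ℕ) (hd : 0 < d)
    -- an arbitrary norm on `ℝᵈ`
    (p : Seminorm ℝ (Fin d → ℝ)) (hp : ∀ x, p x = 0 → x = 0)
    (φ : ℝ≥0 → ℝ≥0) (hφ : OrliczQuantization.IsOrliczFunction φ)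
    -- the original `X`, a random vector with law `P.map X`
    {Ω : Type*} [MeasurableSpace Ω] (P : Measure Ω) [IsProbabilityMeasure P]
    (X : Ω → Fin d → ℝ) (hX : Measurable X)
    (hI_pos : 0 < OrliczQuantization.allocationValue p φ (P.map X))
    (hI_fin : OrliczQuantization.allocationValue p φ (P.map X) < ∞)
    -- asymptotically optimal codebooks of size `N`
    (C : ℕ+ → Finset (Fin d → ℝ)) (hC : ∀ N, (C N).card = N)
    (hopt : limsup (fun N : ℕ+ => ((N : ℕ) : ℝ≥0∞) ^ (1 / (d : ℝ)) *
        OrliczQuantization.orliczNorm φ P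
          (fun ω => OrliczQuantization.codebookDist p (C N) (X ω))) atTop ≤
      OrliczQuantization.allocationValue p φ (P.map X) ^ (1 / (d : ℝ))) :
    IsTightMeasureSet (Set.range fun N : ℕ+ =>
      (OrliczQuantization.empiricalMeasure N (C N) (hC N) : Measure (Fin d → ℝ))) ∧
    (∀ ν : ProbabilityMeasure (Fin d → ℝ),
      MapClusterPt ν atTop
        (fun N : ℕ+ => OrliczQuantization.empiricalMeasure N (C N) (hC N)) →
      ν ∈ OrliczQuantization.minimizerMeasures p φ (P.map X)) ∧
    (StrictConvexOn ℝ≥0 (Set.Ioi 0) (OrliczQuantization.g p φ) →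
      ∃ ν : ProbabilityMeasure (Fin d → ℝ),
        OrliczQuantization.minimizerMeasures p φ (P.map X) = {ν} ∧
        Tendsto (fun N : ℕ+ => OrliczQuantization.empiricalMeasure N (C N) (hC N))
          atTop (𝓝 ν)) := by
  have hμ : IsProbabilityMeasure (P.map X) := Measure.isProbabilityMeasure_map hX.aemeasurable
  have hcost : ∀ J : ℝ≥0, (OrliczQuantization.allocationValue p φ (P.map X)).toNNReal < J →
      ∀ᶠ N : ℕ+ in atTop, ∫⁻ x, (φ ((((N : ℕ) : ℝ≥0) / J) ^ (1 / (d : ℝ)) *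
        OrliczQuantization.codebookDist p (C N) x) : ℝ≥0∞) ∂(P.map X) ≤ 1 := fun J hJ =>
    OrliczQuantization.eventually_lintegral_le_one hφ.monotone hd hX hopt (by
      rwa [← ENNReal.coe_lt_coe, ENNReal.coe_toNNReal hI_fin.ne] at hJ)
  have htight : IsTightMeasureSet (Set.range fun N : ℕ+ =>
      (OrliczQuantization.empiricalMeasure N (C N) (hC N) : Measure (Fin d → ℝ))) := by
    -- Escaping mass would leave a limit of mass at most `a < 1`, whose density must nevertheless
    -- integrate to at least `1`.
    by_contra hnot
    obtain ⟨𝒰, h𝒰, a, ha, hK⟩ :=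
      OrliczQuantization.exists_ultrafilter_of_not_isTightMeasureSet hC hnot
    obtain ⟨ν, hνa, hν⟩ := OrliczQuantization.exists_measure_limit_ultrafilter 𝒰 _ a hK
    have : IsFiniteMeasure ν := ⟨hνa.trans_lt ENNReal.coe_lt_top⟩
    have h1 := OrliczQuantization.one_le_lintegral_of_lintegral_g_le hI_pos hI_fin
      (Measure.measurable_rnDeriv _ _).ennreal_toNNReal
      (OrliczQuantization.lintegral_g_rnDeriv_le_one hd hφ.monotone hp 𝒰 h𝒰 hC hcost ν hν)
    have h2 : ∫⁻ x, ((ν.rnDeriv volume x).toNNReal : ℝ≥0∞) ≤ a :=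
      (lintegral_mono fun x => ENNReal.coe_toNNReal_le_self).trans
        (Measure.lintegral_rnDeriv_le.trans hνa)
    exact (h1.trans h2).not_gt (by exact_mod_cast ha)
  have hacc : ∀ ν : ProbabilityMeasure (Fin d → ℝ),
      MapClusterPt ν atTop
        (fun N : ℕ+ => OrliczQuantization.empiricalMeasure N (C N) (hC N)) →
      ν ∈ OrliczQuantization.minimizerMeasures p φ (P.map X) := by
    intro ν hν
    obtain ⟨𝒰, h𝒰, hlim⟩ := mapClusterPt_iff_ultrafilter.1 hν
    exact OrliczQuantization.mem_minimizerMeasures hd hφ.monotone hI_pos hI_fin ν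
      (OrliczQuantization.lintegral_g_rnDeriv_le_one hd hφ.monotone hp 𝒰 h𝒰 hC hcost _
        fun K hK => ProbabilityMeasure.limsup_measure_closed_le_of_tendsto hlim hK.isClosed)
  refine ⟨htight, hacc, fun hconv => ?_⟩
  set u : ℕ+ → ProbabilityMeasure (Fin d → ℝ) :=
    fun N => OrliczQuantization.empiricalMeasure N (C N) (hC N) with hu
  have hcompact : IsCompact (closure (Set.range u)) := by
    refine isCompact_closure_of_isTightMeasureSet (htight.subset ?_)
    rintro _ ⟨_, ⟨N, rfl⟩, rfl⟩
    exact ⟨N, rfl⟩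
  have hmem : ∀ᶠ N in atTop, u N ∈ closure (Set.range u) :=
    Eventually.of_forall fun N => subset_closure (mem_range_self N)
  obtain ⟨ν, -, hν⟩ := hcompact.exists_mapClusterPt (tendsto_principal.2 hmem)
  have huniq : ∀ ν' ∈ OrliczQuantization.minimizerMeasures p φ (P.map X), ν' = ν :=
    fun ν' hν' => OrliczQuantization.eq_of_mem_minimizerMeasures hd hφ.monotone hI_pos hI_fin
      hconv hν' (hacc ν hν)
  exact ⟨ν, Set.eq_singleton_iff_unique_mem.2 ⟨hacc ν hν, huniq⟩,
    hcompact.tendsto_nhds_of_unique_mapClusterPt hmem fun ν' _ hν' => huniq ν' (hacc ν' hν')⟩
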